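/- **Setting.** Let $G$ be a finite connected simple undirected graph with $n\ge 2$ vertices, graph distance $d$, diameter $\operatorname{diam}(G)$ and maximum degree $\Delta(G)$. A cop and a robber start at vertices $c$ and $r$. Let $y_t$ and $x_t$ be the positions of the cop and the robber after $t$ moves. In move $t+1$ the cop, who sees everything, first steps from $y_t$ to an adjacent vertex $y_{t+1}$; then the robber steps from $x_t$ to a vertex $x_{t+1}$ which, given everything that has happened so far (including the cop's latest step), is uniformly distributed on the neighbours of $x_t$. The capture time $T$ is the number of the first move in which the cop lands on the robber's vertex or the robber on the cop's ($T=0$ if $r=c$). **The four-stage strategy.** Until the capture, the cop moves as follows. 1. For the first $s_1=d(c,r)$ moves she walks along a geodesic to the robber's initial position $x_0=r$. 2. For the next $d(y_{s_1},x_{s_1})$ moves she walks along a geodesic to $x_{s_1}$, the robber's position at the end of Stage 1. Let $s_2=s_1+d(y_{s_1},x_{s_1})$. 3. For $i=0,1,2,\dots$, as long as $d(y_{s_2+4i},x_{s_2+4i})\ge 4$, she takes $x_{s_2+4i}$ as her target and makes her next four steps along a geodesic towards it. 4. From the first $i$ with $d(y_{s_2+4i},x_{s_2+4i})\le 3$ on,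 she plays greedily: in each move she steps to a neighbour of her current vertex that is at minimal distance from the robber's current vertex. Ties (between geodesics or between greedy steps) may be broken in any way, possibly depending on the past and on additional randomness. **Theorem.** There is a function $f:\mathbb N\to\mathbb R$ with $f(n)=o(n)$ such that for every connected simple undirected graph $G$ on $n\ge2$ vertices, all starting vertices $c,r$, and every cop who uses the four-stage strategy, $$\mathbb E[T]\le \operatorname{diam}(G)+\Delta(G)+f(n)\qquad\text{and}\qquad \mathbb E[T]\le n+f(n).$$ -/

import Mathlib

open MeasureTheory Filter Asymptotics
open scoped ENNReal

namespace DrunkRobber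

/-! A play is described by `x y : ℕ → V`: `x t` and `y t` are the positions of the robber and of the
cop after `t` moves. In move `t + 1` the cop first steps from `y t` to `y (t + 1)` while the robber
is on `x t`; then the robber steps from `x t` to `x (t + 1)`. -/

/-- The robber is caught at move `t`: the cop has landed on the robber's vertex, or the robber on
the cop's. At `t = 0` this means that both start on the same vertex. -/
def CaughtAt {V : Type*} (x y : ℕ → V) (t : ℕ) : Prop :=
  x t = y t ∨ ∃ s, t = s + 1 ∧ y (s + 1) = x s

/-- The robber is still free after `t` moves. -/
def FreeAt {V : Type*} (x y : ℕ → V) (t : ℕ) : Prop :=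
  ∀ s ≤ t, ¬ CaughtAt x y s

/-- The number of the first move at which the robber is caught (`⊤` if he never is). -/
noncomputable def captureTime {V : Type*} (x y : ℕ → V) : ℕ∞ :=
  ⨅ (t : ℕ) (_ : CaughtAt x y t), (t : ℕ∞)

/-- A step from `a` to an adjacent vertex `b` along a geodesic from `a` to `w`. -/
def StepsToward {V : Type*} (G : SimpleGraph V) (a b w : V) : Prop :=
  G.Adj a b ∧ G.dist b w + 1 = G.dist a w

/-- A greedy step from `a` to an adjacent vertex `b`: among all the neighbours of `a`, `b` is at
minimal distance from `w`. -/
def GreedyStep {V : Type*} (G : SimpleGraph V) (a b w : V) : Prop :=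
  G.Adj a b ∧ ∀ c, G.Adj a c → G.dist b w ≤ G.dist c w

/-- The number of moves after which Stage 1 ends: the initial distance of the players. -/
noncomputable def stage1End {V : Type*} (G : SimpleGraph V) (x y : ℕ → V) : ℕ :=
  G.dist (y 0) (x 0)

/-- The number of moves after which Stage 2 ends: Stage 2 lasts as many moves as the distance of
the players at the end of Stage 1. -/
noncomputable def stage2End {V : Type*} (G : SimpleGraph V) (x y : ℕ → V) : ℕ :=
  stage1End G x y + G.dist (y (stage1End G x y)) (x (stage1End G x y))

/-- Stage 3 has not terminated when it is the cop's turn after `t` moves: at each retargeting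
moment so far (every fourth move, counted from the end of Stage 2) the players were at distance at
least `4`. -/
def StillRetargeting {V : Type*} (G : SimpleGraph V) (x y : ℕ → V) (t : ℕ) : Prop :=
  ∀ i : ℕ, stage2End G x y + 4 * i ≤ t →
    4 ≤ G.dist (y (stage2End G x y + 4 * i)) (x (stage2End G x y + 4 * i))

/-- Until the capture, the cop's moves in the play `x, y` obey the four-stage strategy.
Ties (between geodesics, or between equally good greedy steps) may be broken in any way. -/
structure FollowsFourStages {V : Type*} (G : SimpleGraph V) (x y : ℕ → V) : Prop where
  /-- Stage 1: walk along a geodesic to the robber's initial position. -/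
  stage1 : ∀ t, FreeAt x y t → t < stage1End G x y →
    StepsToward G (y t) (y (t + 1)) (x 0)
  /-- Stage 2: walk along a geodesic to the robber's position at the end of Stage 1. -/
  stage2 : ∀ t, FreeAt x y t → stage1End G x y ≤ t → t < stage2End G x y →
    StepsToward G (y t) (y (t + 1)) (x (stage1End G x y))
  /-- Stage 3: in each block of four moves, walk along a geodesic to the position that the robber
  had at the beginning of the block. -/
  stage3 : ∀ t, FreeAt x y t → stage2End G x y ≤ t → StillRetargeting G x y t →
    StepsToward G (y t) (y (t + 1)) (x (stage2End G x y + 4 * ((t - stage2End G x y) / 4)))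
  /-- Stage 4: from the first retargeting moment with distance at most `3` on, play greedily. -/
  stage4 : ∀ t, FreeAt x y t → stage2End G x y ≤ t → ¬ StillRetargeting G x y t →
    GreedyStep G (y t) (y (t + 1)) (x t)

/-- Transition probabilities of the simple random walk. -/
noncomputable def stepProb {V : Type*} [Fintype V] (G : SimpleGraph V) [DecidableRel G.Adj]
    (a b : V) : ℝ≥0∞ :=
  if G.Adj a b then (G.degree a : ℝ≥0∞)⁻¹ else 0

/-- The event that the robber's first `t` moves and the cop's first `t + 1` moves follow `x`, `y`:
all that has happened just before the robber's step in move `t + 1`. -/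
def history {V Ω : Type*} (X Y : ℕ → Ω → V) (t : ℕ) (x y : ℕ → V) : Set Ω :=
  {ω | (∀ s ≤ t, X s ω = x s) ∧ (∀ s ≤ t + 1, Y s ω = y s)}

/-- On a probability space, `X` and `Y` are the positions of a drunk robber starting at `r` and of
a cop starting at `c`: given everything that has happened before, including the cop's latest step,
the robber steps to a uniformly random neighbour. The cop may act on the past and on randomness of
her own, but not on the robber's future. -/
structure IsDrunkGame {V Ω : Type*} [Fintype V] (G : SimpleGraph V) [DecidableRel G.Adj]
    [MeasurableSpace Ω] (P : Measure Ω) (X Y : ℕ → Ω → V) (r c : V) : Prop where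
  measurable_robber : ∀ t a, MeasurableSet {ω | X t ω = a}
  measurable_cop : ∀ t a, MeasurableSet {ω | Y t ω = a}
  robber_start : ∀ ω, X 0 ω = r
  cop_start : ∀ ω, Y 0 ω = c
  robber_step : ∀ (t : ℕ) (x y : ℕ → V) (b : V),
    P (history X Y t x y ∩ {ω | X (t + 1) ω = b}) = P (history X Y t x y) * stepProb G (x t) b

/-- The expected capture time. -/
noncomputable def expectedCaptureTime {V Ω : Type*} [MeasurableSpace Ω] (P : Measure Ω)
    (X Y : ℕ → Ω → V) : ℝ≥0∞ :=
  ∫⁻ ω, ((captureTime (fun t => X t ω) (fun t => Y t ω) : ℕ∞) : ℝ≥0∞) ∂P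

end DrunkRobber

/-!
Stages 1 and 2 last as many moves as the robber's displacements over two stretches of the walk. The
simple random walk is diffusive up to a logarithm: two steps of the walk, conjugated with the
exponential of a Lipschitz function, are almost contracting on `ℓ²(deg)`, which bounds the
exponential moments of the displacement. So Stage 1, of length at most `diam G`, displaces the
robber by `O(√n log n)`, and Stage 2, as long as that displacement, displaces him by only
`n ^ (1/4)` up to logarithms.

Each block of Stage 3 never increases the distance, and decreases it unless the walk is at distance
four from its start after four steps. By the inequality of arithmetic and geometric means over
geodesic paths of length three, every vertex has a chance of order at least `n ^ (-2/3)` that this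
fails. Hence the expected number of blocks is at most `n ^ (1/4 + 2/3) = n ^ (11/12)` up to
logarithms.

In Stage 4 the robber steps towards the cop with probability at least `1 / Δ(G)` in each move, and
after he has done so at most one more move of that kind is possible; this costs `Δ(G) + 1` moves.
Finally `diam G + Δ(G) ≤ n + 2`, because the neighbourhood of a vertex meets at most three levels
of any geodesic.
-/

namespace DrunkRobber

section Distance

variable {V : Type*} {G : SimpleGraph V}

theorem dist_le_dist_add_one_of_adj (x : V) {a b : V} (h : G.Adj a b) :
    G.dist x b ≤ G.dist x a + 1 := by
  have := h.diff_dist_adj (u := x)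
  omega

theorem abs_dist_sub_dist_le_one_of_adj (x : V) {a b : V} (h : G.Adj a b) :
    |(G.dist x b : ℝ) - G.dist x a| ≤ 1 := by
  have hab : (G.dist x b : ℝ) ≤ G.dist x a + 1 := mod_cast dist_le_dist_add_one_of_adj x h
  have hba : (G.dist x a : ℝ) ≤ G.dist x b + 1 := mod_cast dist_le_dist_add_one_of_adj x h.symm
  exact abs_sub_le_iff.2 ⟨by linarith, by linarith⟩

theorem exists_forall_le_diam_dist_eq [Finite V] (hG : G.Connected) :
    ∃ u : V, ∀ j ≤ G.diam, ∃ v, G.dist u v = j := by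
  have := hG.nonempty
  obtain ⟨u, w, huw⟩ := G.exists_dist_eq_diam
  obtain ⟨p, hp⟩ := hG.exists_walk_length_eq_dist u w
  refine ⟨u, fun j hj => ⟨p.getVert j, ?_⟩⟩
  have htake : G.dist u (p.getVert j) ≤ j := (SimpleGraph.dist_le (p.take j)).trans (by simp)
  have hdrop : G.dist (p.getVert j) w ≤ p.length - j :=
    (SimpleGraph.dist_le (p.drop j)).trans (by simp)
  have htriangle := hG.dist_triangle (u := u) (v := p.getVert j) (w := w)
  omega

theorem diam_add_maxDegree_le [Fintype V] [DecidableRel G.Adj] (hG : G.Connected) :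
    G.diam + G.maxDegree ≤ Fintype.card V + 2 := by
  classical
  have := hG.nonempty
  obtain ⟨u, hu⟩ := exists_forall_le_diam_dist_eq hG
  obtain ⟨w, hw⟩ := G.exists_maximal_degree_vertex
  set k := G.dist u w
  have hlevels : Finset.range (G.diam + 1) \ {k - 1, k, k + 1} ⊆
      (Finset.univ \ G.neighborFinset w).image (G.dist u) := by
    intro j hj
    simp only [Finset.mem_sdiff, Finset.mem_range, Finset.mem_insert, Finset.mem_singleton,
      not_or] at hj
    obtain ⟨v, hv⟩ := hu j (by omega)
    refine Finset.mem_image.2 ⟨v, ?_, hv⟩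
    simp only [Finset.mem_sdiff, Finset.mem_univ, true_and, SimpleGraph.mem_neighborFinset]
    intro hwv
    have := hwv.diff_dist_adj (u := u)
    omega
  have hcard := (Finset.card_le_card hlevels).trans Finset.card_image_le
  have hremoved := Finset.le_card_sdiff {k - 1, k, k + 1} (Finset.range (G.diam + 1))
  have hthree : ({k - 1, k, k + 1} : Finset ℕ).card ≤ 3 := Finset.card_le_three
  rw [Finset.card_sdiff_of_subset (Finset.subset_univ _), Finset.card_univ,
    SimpleGraph.card_neighborFinset_eq_degree, ← hw] at hcard
  rw [Finset.card_range] at hremoved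
  have hlt : G.maxDegree < Fintype.card V := hw ▸ G.degree_lt_card_verts w
  omega

end Distance

section WalkAverage

variable {V : Type*} [Fintype V] {G : SimpleGraph V} [DecidableRel G.Adj] {f g : V → ℝ} {a : V}

variable (G) in
/-- The transition operator of the simple random walk: `walkAvg G f a` is the average of `f` over
the neighbours of `a`, and `(walkAvg G)^[t] f a` is the expectation of `f` after `t` steps of the
walk from `a`. It is `0` at an isolated vertex. -/
noncomputable def walkAvg (f : V → ℝ) (a : V) : ℝ :=
  (∑ b ∈ G.neighborFinset a, f b) / G.degree a

theorem walkAvg_mono (h : ∀ b, G.Adj a b → f b ≤ g b) : walkAvg G f a ≤ walkAvg G g a := by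
  unfold walkAvg
  gcongr with b hb
  exact h b (by simpa using hb)

theorem walkAvg_congr (h : ∀ b, G.Adj a b → f b = g b) : walkAvg G f a = walkAvg G g a :=
  le_antisymm (walkAvg_mono fun b hb => (h b hb).le) (walkAvg_mono fun b hb => (h b hb).ge)

theorem walkAvg_nonneg (h : ∀ b, G.Adj a b → 0 ≤ f b) : 0 ≤ walkAvg G f a :=
  div_nonneg (Finset.sum_nonneg fun b hb => h b (by simpa using hb)) (Nat.cast_nonneg _)

theorem walkAvg_add (f g : V → ℝ) (a : V) :
    walkAvg G (fun b => f b + g b) a = walkAvg G f a + walkAvg G g a := by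
  simp only [walkAvg, Finset.sum_add_distrib, add_div]

theorem walkAvg_const_mul (k : ℝ) (f : V → ℝ) (a : V) :
    walkAvg G (fun b => k * f b) a = k * walkAvg G f a := by
  simp only [walkAvg, ← Finset.mul_sum, mul_div_assoc]

theorem walkAvg_const (ha : 0 < G.degree a) (k : ℝ) : walkAvg G (fun _ => k) a = k := by
  have : (G.degree a : ℝ) ≠ 0 := by positivity
  simp only [walkAvg, Finset.sum_const, nsmul_eq_mul, SimpleGraph.card_neighborFinset_eq_degree]
  field_simp

theorem le_walkAvg (ha : 0 < G.degree a) {k : ℝ} (h : ∀ b, G.Adj a b → k ≤ f b) :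
    k ≤ walkAvg G f a :=
  (walkAvg_const ha k).ge.trans (walkAvg_mono h)

theorem walkAvg_le (ha : 0 < G.degree a) {k : ℝ} (h : ∀ b, G.Adj a b → f b ≤ k) :
    walkAvg G f a ≤ k :=
  (walkAvg_mono h).trans (walkAvg_const ha k).le

theorem degree_mul_walkAvg (f : V → ℝ) (a : V) :
    G.degree a * walkAvg G f a = ∑ b ∈ G.neighborFinset a, f b := by
  unfold walkAvg
  rcases (G.degree a).eq_zero_or_pos with h | h
  · have : G.neighborFinset a = ∅ := by
      rw [← Finset.card_eq_zero, SimpleGraph.card_neighborFinset_eq_degree, h]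
    simp [h, this]
  · field_simp

theorem inv_degree_le_walkAvg (hf : ∀ b, 0 ≤ f b) {b : V} (hab : G.Adj a b) (hb : 1 ≤ f b) :
    (G.degree a : ℝ)⁻¹ ≤ walkAvg G f a := by
  rw [inv_eq_one_div, walkAvg]
  gcongr
  exact hb.trans (Finset.single_le_sum (fun c _ => hf c) (by simpa using hab))

theorem sum_neighborFinset_comm (F : V → V → ℝ) :
    ∑ a, ∑ b ∈ G.neighborFinset a, F a b = ∑ b, ∑ a ∈ G.neighborFinset b, F a b :=
  Finset.sum_comm' fun a b => by simp [G.adj_comm]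

theorem sum_mul_degree_mul_walkAvg_comm (f g : V → ℝ) :
    ∑ a, f a * (G.degree a * walkAvg G g a) = ∑ b, g b * (G.degree b * walkAvg G f b) := by
  simp only [degree_mul_walkAvg, Finset.mul_sum]
  rw [sum_neighborFinset_comm (G := G) fun a b => f a * g b]
  simp only [mul_comm]

theorem sq_walkAvg_mul_le (f g : V → ℝ) (a : V) :
    walkAvg G (fun b => f b * g b) a ^ 2 ≤
      walkAvg G (fun b => f b ^ 2) a * walkAvg G (fun b => g b ^ 2) a := by
  unfold walkAvg
  rw [div_pow, div_mul_div_comm, ← sq]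
  gcongr
  exact Finset.sum_mul_sq_le_sq_mul_sq _ _ _

variable (G) in
theorem monotone_walkAvg : Monotone (walkAvg G) :=
  fun _ _ h _ => walkAvg_mono fun b _ => h b

theorem walkAvg_iterate_nonneg (hf : ∀ b, 0 ≤ f b) (t : ℕ) (a : V) :
    0 ≤ (walkAvg G)^[t] f a := by
  have h0 : walkAvg G 0 = 0 := by ext; simp [walkAvg]
  simpa [Function.iterate_fixed h0] using (monotone_walkAvg G).iterate t (show 0 ≤ f from hf) a

theorem walkAvg_iterate_affine (hdeg : ∀ a, 0 < G.degree a) (k l : ℝ) (f : V → ℝ) (t : ℕ)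
    (a : V) :
    (walkAvg G)^[t] (fun b => k * f b + l) a = k * (walkAvg G)^[t] f a + l := by
  induction t generalizing a with
  | zero => rfl
  | succ t ih =>
    simp only [Function.iterate_succ_apply']
    rw [walkAvg_congr fun b _ => ih b, walkAvg_add, walkAvg_const_mul, walkAvg_const (hdeg a)]

/-- The Schur test on `ℓ²(deg)`. -/
theorem sum_degree_mul_sq_walkAvg_mul_le {u v : V → V → ℝ} {A B : ℝ} (hA : 0 ≤ A)
    (hu : ∀ a, walkAvg G (fun b => u a b ^ 2) a ≤ A)
    (hv : ∀ b, walkAvg G (fun a => v a b ^ 2) b ≤ B) (f : V → ℝ) :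
    ∑ a, G.degree a * walkAvg G (fun b => u a b * (v a b * f b)) a ^ 2 ≤
      A * B * ∑ a, G.degree a * f a ^ 2 :=
  calc
    _ ≤ ∑ a, G.degree a * (A * walkAvg G (fun b => (v a b * f b) ^ 2) a) := by
      gcongr with a
      exact (sq_walkAvg_mul_le _ _ _).trans
        (mul_le_mul_of_nonneg_right (hu a) (walkAvg_nonneg fun b _ => sq_nonneg _))
    _ = A * ∑ b, ∑ a ∈ G.neighborFinset b, (v a b * f b) ^ 2 := by
      rw [← sum_neighborFinset_comm fun a b => (v a b * f b) ^ 2, Finset.mul_sum]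
      simp only [← degree_mul_walkAvg, mul_left_comm A]
    _ = A * ∑ b, G.degree b * f b ^ 2 * walkAvg G (fun a => v a b ^ 2) b := by
      simp only [mul_pow, mul_right_comm _ (f _ ^ 2), degree_mul_walkAvg, Finset.sum_mul]
    _ ≤ A * ∑ b, G.degree b * f b ^ 2 * B := by
      gcongr with b
      exact hv b
    _ = _ := by rw [← Finset.sum_mul]; ring

end WalkAverage

section Diffusivity

variable {V : Type*} [Fintype V] {G : SimpleGraph V} [DecidableRel G.Adj] {φ : V → ℝ}

theorem exp_le_add_exp_sq (x : ℝ) : Real.exp x ≤ x + Real.exp (x ^ 2) := by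
  have hsq := Real.add_one_le_exp (x ^ 2)
  rcases le_total x 1 with h1 | h1
  · rcases le_total (-1) x with h0 | h0
    · linarith [(abs_le.1 (Real.abs_exp_sub_one_sub_id_le (abs_le.2 ⟨h0, h1⟩))).2]
    · nlinarith [Real.exp_le_one_iff.2 (by linarith : x ≤ 0)]
  · linarith [Real.exp_le_exp.2 (by nlinarith : x ≤ x ^ 2)]

/-- A crude form of Hoeffding's lemma. -/
theorem walkAvg_exp_centered_le {a : V} (ha : 0 < G.degree a)
    (hφ : ∀ b, G.Adj a b → |φ b - φ a| ≤ 1) (u : ℝ) :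
    walkAvg G (fun b => Real.exp (u * (φ b - walkAvg G φ a))) a ≤ Real.exp (4 * u ^ 2) := by
  set m := walkAvg G φ a with hm
  have hupper : m ≤ φ a + 1 := walkAvg_le ha fun b hb => by linarith [(abs_le.1 (hφ b hb)).2]
  have hlower : φ a - 1 ≤ m := le_walkAvg ha fun b hb => by linarith [(abs_le.1 (hφ b hb)).1]
  calc walkAvg G (fun b => Real.exp (u * (φ b - m))) a
      ≤ walkAvg G (fun b => u * φ b + (Real.exp (4 * u ^ 2) - u * m)) a := by
        refine walkAvg_mono fun b hb => (exp_le_add_exp_sq _).trans ?_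
        have hdev : (φ b - m) ^ 2 ≤ 4 := by nlinarith [abs_le.1 (hφ b hb)]
        have : Real.exp ((u * (φ b - m)) ^ 2) ≤ Real.exp (4 * u ^ 2) :=
          Real.exp_le_exp.2 (by rw [mul_pow]; nlinarith [sq_nonneg u])
        linarith
    _ = Real.exp (4 * u ^ 2) := by
        rw [walkAvg_add, walkAvg_const_mul, walkAvg_const ha, ← hm]; ring

theorem walkAvg_sq_exp_centered_le {a : V} (ha : 0 < G.degree a)
    (hφ : ∀ b, G.Adj a b → |φ b - φ a| ≤ 1) (u : ℝ) :
    walkAvg G (fun b => Real.exp (u * (φ b - walkAvg G φ a)) ^ 2) a ≤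
      Real.exp (16 * u ^ 2) := by
  convert walkAvg_exp_centered_le ha hφ (2 * u) using 2
  · ext b
    rw [← Real.exp_nat_mul]
    push_cast
    ring_nf
  · ring

/-- The conjugated operator factors into two kernels, one centred with respect to the average
around its first variable, the other around its second; each passes the Schur test. -/
theorem sum_degree_mul_sq_conj_le (hdeg : ∀ a, 0 < G.degree a)
    (hφ : ∀ a b, G.Adj a b → |φ b - φ a| ≤ 1) (s : ℝ) (f : V → ℝ) :
    ∑ a, G.degree a *
        (Real.exp (-s * φ a) * walkAvg G (walkAvg G fun b => Real.exp (s * φ b) * f b) a) ^ 2 ≤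
      Real.exp (32 * s ^ 2) * ∑ a, G.degree a * f a ^ 2 := by
  set m := walkAvg G φ
  set g : V → ℝ := fun b => walkAvg G (fun c => Real.exp (s * (φ c - m b)) * f c) b
  have hone : ∀ a, walkAvg G (fun _ => (1 : ℝ) ^ 2) a ≤ 1 := fun a =>
    (walkAvg_const (hdeg a) _).le.trans (one_pow 2).le
  have hinner : ∑ a, G.degree a * g a ^ 2 ≤
      Real.exp (16 * s ^ 2) * 1 * ∑ a, G.degree a * f a ^ 2 := by
    simpa only [one_mul] using sum_degree_mul_sq_walkAvg_mul_le (v := fun _ _ => 1)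
      (Real.exp_nonneg _) (fun a => walkAvg_sq_exp_centered_le (hdeg a) (hφ a) s) hone f
  have houter : ∑ a, G.degree a * walkAvg G (fun b => Real.exp (-s * (φ a - m b)) * g b) a ^ 2 ≤
      1 * Real.exp (16 * (-s) ^ 2) * ∑ a, G.degree a * g a ^ 2 := by
    simpa only [one_mul] using sum_degree_mul_sq_walkAvg_mul_le (u := fun _ _ => 1)
      zero_le_one hone (fun b => walkAvg_sq_exp_centered_le (hdeg b) (hφ b) (-s)) g
  have hfactor : ∀ a, walkAvg G (fun b => Real.exp (-s * (φ a - m b)) * g b) a =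
      Real.exp (-s * φ a) * walkAvg G (walkAvg G fun b => Real.exp (s * φ b) * f b) a := by
    intro a
    simp only [g, ← walkAvg_const_mul, ← mul_assoc, ← Real.exp_add]
    ring_nf
  have hexp : Real.exp (32 * s ^ 2) = Real.exp (16 * (-s) ^ 2) * Real.exp (16 * s ^ 2) := by
    rw [← Real.exp_add]
    ring_nf
  simp only [hfactor, one_mul, mul_one] at hinner houter
  rw [hexp, mul_assoc]
  exact houter.trans (by gcongr)

theorem sum_degree_mul_sq_conj_iterate_le (hdeg : ∀ a, 0 < G.degree a)
    (hφ : ∀ a b, G.Adj a b → |φ b - φ a| ≤ 1) (s : ℝ) (k : ℕ) :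
    ∑ a, G.degree a * (Real.exp (-s * φ a) *
        (walkAvg G)^[2 * k] (fun b => Real.exp (s * φ b)) a) ^ 2 ≤
      Real.exp (32 * s ^ 2 * k) * ∑ a, (G.degree a : ℝ) := by
  induction k with
  | zero => simp [← Real.exp_add]
  | succ k ih =>
    have hstep := sum_degree_mul_sq_conj_le hdeg hφ s
      (fun a => Real.exp (-s * φ a) * (walkAvg G)^[2 * k] (fun b => Real.exp (s * φ b)) a)
    simp only [← mul_assoc (Real.exp (s * φ _)), ← Real.exp_add, neg_mul, add_neg_cancel,
      Real.exp_zero, one_mul] at hstep ih ⊢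
    calc _ ≤ Real.exp (32 * s ^ 2) * (Real.exp (32 * s ^ 2 * k) * ∑ a, (G.degree a : ℝ)) := by
          simp only [mul_add_one, Function.iterate_succ_apply']
          exact hstep.trans (by gcongr)
      _ = _ := by
          rw [← mul_assoc, ← Real.exp_add]
          push_cast
          ring_nf

theorem walkAvg_iterate_exp_le (hdeg : ∀ a, 0 < G.degree a)
    (hφ : ∀ a b, G.Adj a b → |φ b - φ a| ≤ 1) (s : ℝ) (k : ℕ) {x : V} (hx : φ x = 0) :
    (walkAvg G)^[2 * k] (fun b => Real.exp (s * φ b)) x ≤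
      Real.exp (16 * s ^ 2 * k) * Fintype.card V := by
  set g := (walkAvg G)^[2 * k] (fun b => Real.exp (s * φ b))
  have hdeg_x : (1 : ℝ) ≤ G.degree x := by exact_mod_cast hdeg x
  have hsum_deg : ∑ a, (G.degree a : ℝ) ≤ (Fintype.card V : ℝ) ^ 2 := by
    calc _ ≤ ∑ _a : V, (Fintype.card V : ℝ) := by
          gcongr with a
          exact (G.degree_lt_card_verts a).le
      _ = _ := by simp [sq]
  refine abs_le_of_sq_le_sq' ?_ (by positivity) |>.2
  calc g x ^ 2 ≤ G.degree x * (Real.exp (-s * φ x) * g x) ^ 2 := by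
        simpa [hx] using le_mul_of_one_le_left (sq_nonneg (g x)) hdeg_x
    _ ≤ ∑ a, G.degree a * (Real.exp (-s * φ a) * g a) ^ 2 :=
        Finset.single_le_sum (f := fun a => G.degree a * (Real.exp (-s * φ a) * g a) ^ 2)
          (fun a _ => by positivity) (Finset.mem_univ x)
    _ ≤ Real.exp (32 * s ^ 2 * k) * (Fintype.card V : ℝ) ^ 2 :=
        (sum_degree_mul_sq_conj_iterate_le hdeg hφ s k).trans (by gcongr)
    _ = _ := by rw [mul_pow, ← Real.exp_nat_mul]; push_cast; ring_nf

theorem walkAvg_iterate_even_dist_le (hdeg : ∀ a, 0 < G.degree a) {s : ℝ} (hs : 0 < s) (k : ℕ)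
    (x : V) :
    (walkAvg G)^[2 * k] (fun b => (G.dist x b : ℝ)) x ≤
      (Real.log (Fintype.card V) + 1) / s + 16 * s * k := by
  have hn : (0 : ℝ) < Fintype.card V := by exact_mod_cast Fintype.card_pos_iff.2 ⟨x⟩
  set l := Real.log (Fintype.card V) + 16 * s ^ 2 * k with hl
  -- Jensen's inequality in the form of the tangent of `exp` at `l`
  have htangent : (fun b => s * (G.dist x b : ℝ) + 0) ≤
      fun b => Real.exp (-l) * Real.exp (s * (G.dist x b : ℝ)) + l := by
    intro b
    simp only [← Real.exp_add]
    linarith [Real.add_one_le_exp (-l + s * (G.dist x b : ℝ))]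
  have havg := (monotone_walkAvg G).iterate (2 * k) htangent x
  rw [walkAvg_iterate_affine hdeg, walkAvg_iterate_affine hdeg] at havg
  have hmoment : Real.exp (-l) *
      (walkAvg G)^[2 * k] (fun b => Real.exp (s * (G.dist x b : ℝ))) x ≤ 1 := by
    calc _ ≤ Real.exp (-l) * (Real.exp (16 * s ^ 2 * k) * Fintype.card V) := by
          gcongr
          exact walkAvg_iterate_exp_le hdeg (fun a b h => abs_dist_sub_dist_le_one_of_adj x h) s k
            (by simp)
      _ = 1 := by
          rw [hl, neg_add, Real.exp_add, Real.exp_neg, Real.exp_neg, Real.exp_log hn]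
          field_simp
  rw [← mul_le_mul_iff_right₀ hs, mul_add, mul_div_cancel₀ _ hs.ne']
  linarith

theorem walkAvg_iterate_dist_le_of_pos (hdeg : ∀ a, 0 < G.degree a) {s : ℝ} (hs : 0 < s) (t : ℕ)
    (x : V) :
    (walkAvg G)^[t] (fun b => (G.dist x b : ℝ)) x ≤
      (Real.log (Fintype.card V) + 1) / s + 8 * s * t + 1 := by
  obtain ⟨k, rfl | rfl⟩ := t.even_or_odd'
  · have := walkAvg_iterate_even_dist_le hdeg hs k x
    push_cast
    linarith
  · have heven := walkAvg_iterate_even_dist_le hdeg hs k x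
    have hstep : walkAvg G (fun b => (G.dist x b : ℝ)) ≤ fun b => 1 * (G.dist x b : ℝ) + 1 :=
      fun b => walkAvg_le (hdeg b) fun c hc => by
        linarith [(abs_le.1 (abs_dist_sub_dist_le_one_of_adj x hc)).2]
    have hodd := (monotone_walkAvg G).iterate (2 * k) hstep x
    rw [walkAvg_iterate_affine hdeg, ← Function.iterate_succ_apply] at hodd
    push_cast
    linarith

theorem walkAvg_iterate_dist_le (hdeg : ∀ a, 0 < G.degree a) (t : ℕ) (x : V) :
    (walkAvg G)^[t] (fun b => (G.dist x b : ℝ)) x ≤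
      (Real.log (Fintype.card V) + 10) * √t := by
  rcases t.eq_zero_or_pos with rfl | ht
  · simp
  · have hsqrt : 1 ≤ √(t : ℝ) := Real.one_le_sqrt.2 (mod_cast ht)
    have htilt := walkAvg_iterate_dist_le_of_pos hdeg (inv_pos.2 (zero_lt_one.trans_le hsqrt)) t x
    have hdrift : 8 * (√(t : ℝ))⁻¹ * t = 8 * √t := by
      rw [mul_assoc, inv_mul_eq_div, Real.div_sqrt]
    rw [div_inv_eq_mul, hdrift] at htilt
    linarith

end Diffusivity

section Balls

variable {V : Type*} {G : SimpleGraph V}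

variable (G) in
/-- The indicator of the sphere of radius `i` around `x`. -/
noncomputable def sphereInd (x : V) (i : ℕ) : V → ℝ :=
  Set.indicator {v | G.dist x v = i} 1

variable (G) in
/-- The indicator of the closed ball of radius `i` around `x`. -/
noncomputable def ballInd (x : V) (i : ℕ) : V → ℝ :=
  Set.indicator {v | G.dist x v ≤ i} 1

theorem sphereInd_nonneg (x : V) (i : ℕ) (v : V) : 0 ≤ sphereInd G x i v :=
  Set.indicator_nonneg (fun _ _ => zero_le_one) v

theorem sphereInd_le_one (x : V) (i : ℕ) (v : V) : sphereInd G x i v ≤ 1 :=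
  Set.indicator_le_self' (fun _ _ => zero_le_one) v

theorem ballInd_nonneg (x : V) (i : ℕ) (v : V) : 0 ≤ ballInd G x i v :=
  Set.indicator_nonneg (fun _ _ => zero_le_one) v

theorem sphereInd_le_ballInd (x : V) {i j : ℕ} (h : i ≤ j) : sphereInd G x i ≤ ballInd G x j :=
  Set.indicator_le_indicator_of_subset (fun _ (hv : _ = i) => hv.trans_le h)
    fun _ => zero_le_one

theorem ballInd_mono (x : V) {i j : ℕ} (h : i ≤ j) : ballInd G x i ≤ ballInd G x j :=
  Set.indicator_le_indicator_of_subset (fun _ (hv : _ ≤ i) => hv.trans h) fun _ => zero_le_one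

end Balls

section Gain

variable {V : Type*} [Fintype V] {G : SimpleGraph V} [DecidableRel G.Adj] {x : V}

variable (G) in
/-- The density of the step from the sphere of radius `i` to `v` on the next sphere, reweighted to
carry the measure `deg` on the former into the measure `deg` on the latter. It is `0` off that
sphere. -/
noncomputable def backWeight (x : V) (i : ℕ) (v : V) : ℝ :=
  sphereInd G x (i + 1) v / walkAvg G (sphereInd G x i) v

theorem walkAvg_sphereInd_nonneg (x : V) (i : ℕ) (v : V) : 0 ≤ walkAvg G (sphereInd G x i) v :=
  walkAvg_nonneg fun u _ => sphereInd_nonneg x i u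

theorem walkAvg_sphereInd_pos {i : ℕ} {u v : V} (h : G.Adj v u) (hu : G.dist x u = i) :
    0 < walkAvg G (sphereInd G x i) v :=
  (inv_pos.2 (mod_cast (G.degree_pos_iff_exists_adj v).2 ⟨u, h⟩)).trans_le
    (inv_degree_le_walkAvg (sphereInd_nonneg x i) h (by simp [sphereInd, hu]))

theorem backWeight_nonneg (x : V) (i : ℕ) (v : V) : 0 ≤ backWeight G x i v :=
  div_nonneg (sphereInd_nonneg x _ v) (walkAvg_sphereInd_nonneg x i v)

theorem ballInd_le_walkAvg_ballInd (hdeg : ∀ a, 0 < G.degree a) (x : V) (i : ℕ) :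
    ballInd G x i ≤ walkAvg G (ballInd G x (i + 1)) := by
  refine Set.indicator_le' (fun v (hv : _ ≤ i) => le_walkAvg (hdeg v) fun b hb => ?_)
    fun v _ => walkAvg_nonneg fun b _ => ballInd_nonneg x _ b
  have hmem : G.dist x b ≤ i + 1 := (dist_le_dist_add_one_of_adj x hb).trans (by omega)
  simp [ballInd, hmem]

theorem monotone_walkAvg_iterate_ballInd (hdeg : ∀ a, 0 < G.degree a) (x : V) (t : ℕ) :
    Monotone fun i => (walkAvg G)^[i + t] (ballInd G x i) x :=
  monotone_nat_of_le_succ fun i => by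
    rw [add_right_comm, Function.iterate_succ_apply]
    exact (monotone_walkAvg G).iterate _ (ballInd_le_walkAvg_ballInd hdeg x i) x

theorem sum_sphereInd_mul_walkAvg_backWeight_le (x : V) (i : ℕ) {g : V → ℝ} (hg : ∀ v, 0 ≤ g v) :
    ∑ a, sphereInd G x i a * (G.degree a * walkAvg G (fun b => backWeight G x i b * g b) a) ≤
      ∑ b, sphereInd G x (i + 1) b * (G.degree b * g b) := by
  rw [sum_mul_degree_mul_walkAvg_comm]
  refine Finset.sum_le_sum fun b _ => ?_
  calc backWeight G x i b * g b * (G.degree b * walkAvg G (sphereInd G x i) b)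
      = backWeight G x i b * walkAvg G (sphereInd G x i) b * (G.degree b * g b) := by ring
    _ ≤ sphereInd G x (i + 1) b * (G.degree b * g b) := by
        gcongr
        · exact mul_nonneg (Nat.cast_nonneg _) (hg b)
        · exact mul_le_of_le_div₀ (sphereInd_nonneg x _ b) (walkAvg_sphereInd_nonneg x i b) le_rfl

/-- On a geodesic path the integrand is the reciprocal of the conditional probability of the path
given its last vertex, so that its average counts the vertices of the sphere of radius three. -/
theorem walkAvg_backWeight_le_card (hdeg : ∀ a, 0 < G.degree a) (x : V) :
    walkAvg G (fun a => backWeight G x 0 a * walkAvg G (fun b => backWeight G x 1 b *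
      walkAvg G (fun c => backWeight G x 2 c * (G.degree c : ℝ)⁻¹) b) a) x ≤ Fintype.card V := by
  set g₂ : V → ℝ := fun b => walkAvg G (fun c => backWeight G x 2 c * (G.degree c : ℝ)⁻¹) b
  set g₁ : V → ℝ := fun a => walkAvg G (fun b => backWeight G x 1 b * g₂ b) a
  have hg₂ : ∀ b, 0 ≤ g₂ b := fun b =>
    walkAvg_nonneg fun c _ => mul_nonneg (backWeight_nonneg x 2 c) (by positivity)
  have hg₁ : ∀ a, 0 ≤ g₁ a := fun a =>
    walkAvg_nonneg fun b _ => mul_nonneg (backWeight_nonneg x 1 b) (hg₂ b)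
  have hnonneg : ∀ v, 0 ≤ G.degree v * walkAvg G (fun a => backWeight G x 0 a * g₁ a) v :=
    fun v => mul_nonneg (Nat.cast_nonneg _)
      (walkAvg_nonneg fun a _ => mul_nonneg (backWeight_nonneg x 0 a) (hg₁ a))
  calc walkAvg G (fun a => backWeight G x 0 a * g₁ a) x
      ≤ G.degree x * walkAvg G (fun a => backWeight G x 0 a * g₁ a) x :=
        le_mul_of_one_le_left
          (walkAvg_nonneg fun a _ => mul_nonneg (backWeight_nonneg x 0 a) (hg₁ a))
          (mod_cast hdeg x)
    _ ≤ ∑ v, sphereInd G x 0 v *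
          (G.degree v * walkAvg G (fun a => backWeight G x 0 a * g₁ a) v) := by
        have hstart : sphereInd G x 0 x = 1 := by simp [sphereInd]
        simpa only [hstart, one_mul] using Finset.single_le_sum (f := fun v => sphereInd G x 0 v *
          (G.degree v * walkAvg G (fun a => backWeight G x 0 a * g₁ a) v))
          (fun v _ => mul_nonneg (sphereInd_nonneg x 0 v) (hnonneg v)) (Finset.mem_univ x)
    _ ≤ ∑ a, sphereInd G x 1 a * (G.degree a * g₁ a) :=
        sum_sphereInd_mul_walkAvg_backWeight_le x 0 hg₁
    _ ≤ ∑ b, sphereInd G x 2 b * (G.degree b * g₂ b) :=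
        sum_sphereInd_mul_walkAvg_backWeight_le x 1 hg₂
    _ ≤ ∑ c, sphereInd G x 3 c * (G.degree c * (G.degree c : ℝ)⁻¹) :=
        sum_sphereInd_mul_walkAvg_backWeight_le x 2 fun c => by positivity
    _ ≤ ∑ _c : V, (1 : ℝ) := by
        gcongr with c
        exact mul_le_one₀ (sphereInd_le_one x 3 c) (by positivity) mul_inv_le_one
    _ = Fintype.card V := by simp

theorem le_walkAvg_three (hdeg : ∀ a, 0 < G.degree a) {θ θ' κ : ℝ}
    {f₀ f₁ f₂ f₃ w₁ w₂ w₃ : V → ℝ}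
    (h : ∀ a b c, G.Adj x a → G.Adj a b → G.Adj b c →
      θ ≤ θ' * f₀ c + f₁ a + f₂ b + f₃ c + κ * (w₁ a * (w₂ b * w₃ c))) :
    θ ≤ θ' * (walkAvg G)^[3] f₀ x + (walkAvg G)^[1] f₁ x + (walkAvg G)^[2] f₂ x +
      (walkAvg G)^[3] f₃ x +
      κ * walkAvg G (fun a => w₁ a * walkAvg G (fun b => w₂ b * walkAvg G w₃ b) a) x := by
  have hthird : ∀ a b, G.Adj x a → G.Adj a b →
      θ ≤ θ' * walkAvg G f₀ b + f₁ a + f₂ b + walkAvg G f₃ b +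
        κ * (w₁ a * (w₂ b * walkAvg G w₃ b)) := fun a b ha hb => by
    simpa only [walkAvg_add, walkAvg_const_mul, walkAvg_const (hdeg b)] using
      le_walkAvg (hdeg b) fun c hc => h a b c ha hb hc
  have hsecond : ∀ a, G.Adj x a →
      θ ≤ θ' * walkAvg G (walkAvg G f₀) a + f₁ a + walkAvg G f₂ a + walkAvg G (walkAvg G f₃) a +
        κ * (w₁ a * walkAvg G (fun b => w₂ b * walkAvg G w₃ b) a) := fun a ha => by
    simpa only [walkAvg_add, walkAvg_const_mul, walkAvg_const (hdeg a)] using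
      le_walkAvg (hdeg a) fun b hb => hthird a b ha hb
  simpa only [walkAvg_add, walkAvg_const_mul, Function.iterate_succ_apply',
    Function.iterate_zero, id_eq] using le_walkAvg (hdeg x) hsecond

theorem four_mul_le_add_of_pow_four_le {a b c d q : ℝ} (ha : 0 ≤ a) (hb : 0 ≤ b) (hc : 0 ≤ c)
    (hd : 0 ≤ d) (hq : 0 ≤ q) (h : q ^ 4 ≤ a * b * c * d) : 4 * q ≤ a + b + c + d := by
  have hamgm := Real.geom_mean_le_arith_mean4_weighted (w₁ := 4⁻¹) (w₂ := 4⁻¹) (w₃ := 4⁻¹)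
    (w₄ := 4⁻¹) (by norm_num) (by norm_num) (by norm_num) (by norm_num) ha hb hc hd (by norm_num)
  have hroot : q ≤ (a * b * c * d) ^ (4⁻¹ : ℝ) := by
    rw [← Real.pow_rpow_inv_natCast hq four_ne_zero]
    exact Real.rpow_le_rpow (by positivity) h (by norm_num)
  rw [Real.mul_rpow (by positivity) hd, Real.mul_rpow (by positivity) hc,
    Real.mul_rpow ha hb] at hroot
  linarith

/-- If the path is not a geodesic, the ball term wins; otherwise the product of the other four terms
is `q / (n * deg c)`, at least `q ^ 4` by the choice of `q`. -/
theorem four_mul_le_along_path {q : ℝ} (hq : 0 < q) (hqn : q ^ 3 * (Fintype.card V : ℝ) ^ 2 = 1)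
    {a b c : V} (ha : G.Adj x a) (hb : G.Adj a b) (hc : G.Adj b c) :
    4 * q ≤ 4 * q * ballInd G x 2 c + walkAvg G (sphereInd G x 0) a +
      walkAvg G (sphereInd G x 1) b + walkAvg G (sphereInd G x 2) c +
      q / Fintype.card V * (backWeight G x 0 a *
        (backWeight G x 1 b * (backWeight G x 2 c * (G.degree c : ℝ)⁻¹))) := by
  have hn : (0 : ℝ) < Fintype.card V := by exact_mod_cast Fintype.card_pos_iff.2 ⟨x⟩
  have havg := walkAvg_sphereInd_nonneg (G := G) x
  have hweight := backWeight_nonneg (G := G) x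
  have hxa : G.dist x a = 1 := SimpleGraph.dist_eq_one_iff_adj.2 ha
  have hxb := dist_le_dist_add_one_of_adj x hb
  have hxc := dist_le_dist_add_one_of_adj x hc
  have hlast : 0 ≤ q / Fintype.card V * (backWeight G x 0 a *
      (backWeight G x 1 b * (backWeight G x 2 c * (G.degree c : ℝ)⁻¹))) :=
    mul_nonneg (by positivity) (mul_nonneg (hweight 0 a)
      (mul_nonneg (hweight 1 b) (mul_nonneg (hweight 2 c) (by positivity))))
  by_cases hnear : G.dist x c ≤ 2
  · have hball : ballInd G x 2 c = 1 := by simp [ballInd, hnear]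
    rw [hball]
    linarith [havg 0 a, havg 1 b, havg 2 c]
  · have hball : ballInd G x 2 c = 0 := by simp [ballInd, hnear]
    have hweight_eq : ∀ {i v}, G.dist x v = i + 1 →
        backWeight G x i v = (walkAvg G (sphereInd G x i) v)⁻¹ := fun h => by
      simp [backWeight, sphereInd, h]
    rw [hball, mul_zero, zero_add]
    refine four_mul_le_add_of_pow_four_le (havg 0 a) (havg 1 b) (havg 2 c) hlast hq.le ?_
    rw [hweight_eq hxa, hweight_eq (by omega : _ = 1 + 1), hweight_eq (by omega : _ = 2 + 1)]
    have h0 := (walkAvg_sphereInd_pos ha.symm (by simp : G.dist x x = 0)).ne'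
    have h1 := (walkAvg_sphereInd_pos hb.symm hxa).ne'
    have h2 := (walkAvg_sphereInd_pos hc.symm (by omega : G.dist x b = 2)).ne'
    have hdeg_c : (0 : ℝ) < G.degree c := mod_cast hc.degree_pos_right
    have hdeg_le : (G.degree c : ℝ) ≤ Fintype.card V := mod_cast (G.degree_lt_card_verts c).le
    calc q ^ 4 = q / (Fintype.card V * Fintype.card V) := by
          field_simp
          linear_combination hqn
      _ ≤ q / (Fintype.card V * G.degree c) := by gcongr
      _ = _ := by field_simp

theorem walkAvg_iterate_four_ballInd_ge (hdeg : ∀ a, 0 < G.degree a) {q : ℝ} (hq : 0 < q)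
    (hqn : q ^ 3 * (Fintype.card V : ℝ) ^ 2 = 1) (x : V) :
    3 / 7 * q ≤ (walkAvg G)^[4] (ballInd G x 3) x := by
  have hn : (1 : ℝ) ≤ Fintype.card V := by exact_mod_cast Fintype.card_pos_iff.2 ⟨x⟩
  have hq1 : q ≤ 1 := by
    refine (pow_le_one_iff_of_nonneg hq.le three_ne_zero).1 ?_
    exact (le_mul_of_one_le_right (by positivity) (one_le_pow₀ hn)).trans hqn.le
  set ε := (walkAvg G)^[4] (ballInd G x 3) x
  have hball : (walkAvg G)^[3] (ballInd G x 2) x ≤ ε :=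
    monotone_walkAvg_iterate_ballInd hdeg x 1 (by norm_num : 2 ≤ 3)
  have hsphere : ∀ i ≤ 2, (walkAvg G)^[i + 1] (walkAvg G (sphereInd G x i)) x ≤ ε := by
    intro i hi
    rw [← Function.iterate_succ_apply]
    calc _ ≤ (walkAvg G)^[i + 2] (ballInd G x i) x :=
          (monotone_walkAvg G).iterate _ (sphereInd_le_ballInd x le_rfl) x
      _ ≤ (walkAvg G)^[4] (ballInd G x 2) x := monotone_walkAvg_iterate_ballInd hdeg x 2 hi
      _ ≤ ε := (monotone_walkAvg G).iterate 4 (ballInd_mono x (by norm_num)) x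
  have hpath := le_walkAvg_three (x := x) hdeg fun a b c ha hb hc =>
    four_mul_le_along_path hq hqn ha hb hc
  have hweight := mul_le_mul_of_nonneg_left (walkAvg_backWeight_le_card hdeg x)
    (by positivity : 0 ≤ q / Fintype.card V)
  rw [div_mul_cancel₀ _ (by positivity)] at hweight
  have hnear : 4 * q * (walkAvg G)^[3] (ballInd G x 2) x ≤ 4 * ε :=
    mul_le_mul (by linarith) hball (walkAvg_iterate_nonneg (ballInd_nonneg x 2) 3 x) (by norm_num)
  linarith [hsphere 0 (by norm_num), hsphere 1 (by norm_num), hsphere 2 le_rfl]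

end Gain

section Capture

variable {V : Type*} {x y : ℕ → V}

theorem FreeAt.mono {s t : ℕ} (h : FreeAt x y t) (hst : s ≤ t) : FreeAt x y s :=
  fun u hu => h u (hu.trans hst)

theorem FreeAt.ne {t : ℕ} (h : FreeAt x y t) : x t ≠ y t :=
  fun heq => h t le_rfl (Or.inl heq)

theorem FreeAt.ne_of_succ {t : ℕ} (h : FreeAt x y (t + 1)) : y (t + 1) ≠ x t :=
  fun heq => h (t + 1) le_rfl (Or.inr ⟨t, rfl, heq⟩)

open scoped Classical in
theorem captureTime_le_tsum (x y : ℕ → V) :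
    ((captureTime x y : ℕ∞) : ℝ≥0∞) ≤ ∑' t, if FreeAt x y t then 1 else 0 := by
  by_cases h : ∃ t, CaughtAt x y t
  · have hfree : ∀ t ∈ Finset.range (Nat.find h), FreeAt x y t := fun t ht s hs =>
      Nat.find_min h (hs.trans_lt (Finset.mem_range.1 ht))
    have hle : captureTime x y ≤ (Nat.find h : ℕ∞) := iInf₂_le _ (Nat.find_spec h)
    calc ((captureTime x y : ℕ∞) : ℝ≥0∞)
        ≤ ((Nat.find h : ℕ∞) : ℝ≥0∞) := by exact_mod_cast hle
      _ = ∑ t ∈ Finset.range (Nat.find h), if FreeAt x y t then 1 else 0 := by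
          rw [Finset.sum_congr rfl fun t ht => if_pos (hfree t ht)]
          simp
      _ ≤ _ := ENNReal.sum_le_tsum _
  · push Not at h
    have hfree : ∀ t, FreeAt x y t := fun t s _ => h s
    simp [hfree]

end Capture

theorem count_le_one {p : ℕ → Prop} [DecidablePred p] (h : ∀ s t, s < t → p s → ¬ p t) (N : ℕ) :
    Nat.count p N ≤ 1 := by
  rw [Nat.count_eq_card_filter_range, Finset.card_le_one]
  intro s hs t ht
  have hps := (Finset.mem_filter.1 hs).2
  have hpt := (Finset.mem_filter.1 ht).2
  exact le_antisymm (not_lt.1 fun hts => h t s hts hpt hps) (not_lt.1 fun hst => h s t hst hps hpt)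

section Stages

variable {V : Type*} {G : SimpleGraph V} {x y : ℕ → V}

theorem exists_adj_dist_add_one_eq (hG : G.Connected) {a w : V} (haw : a ≠ w) :
    ∃ b, G.Adj a b ∧ G.dist b w + 1 = G.dist a w := by
  obtain ⟨p, hp⟩ := hG.exists_walk_length_eq_dist a w
  cases p with
  | nil => exact absurd rfl haw
  | @cons _ b _ hab q =>
    refine ⟨b, hab, ?_⟩
    rw [SimpleGraph.Walk.length_cons] at hp
    have hbw : G.dist b w ≤ q.length := SimpleGraph.dist_le q
    have haw : G.dist a w ≤ G.dist b w + 1 := by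
      simpa only [G.dist_comm (v := w)] using dist_le_dist_add_one_of_adj w hab.symm
    omega

theorem GreedyStep.dist_add_one_le (hG : G.Connected) {a b w : V} (h : GreedyStep G a b w)
    (haw : a ≠ w) : G.dist b w + 1 ≤ G.dist a w := by
  obtain ⟨c, hac, hcw⟩ := exists_adj_dist_add_one_eq hG haw
  have := h.2 c hac
  omega

theorem dist_add_eq_of_stepsToward {w : V} {a m : ℕ}
    (h : ∀ t, a ≤ t → t < a + m → StepsToward G (y t) (y (t + 1)) w) :
    G.dist (y (a + m)) w + m = G.dist (y a) w := by
  induction m with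
  | zero => rfl
  | succ m ih =>
    have hstep := (h (a + m) (by omega) (by omega)).2
    have hprev := ih fun t hat htm => h t hat (by omega)
    rw [← add_assoc a m 1]
    omega

theorem dist_add_le_of_adj_succ (hx : ∀ t, G.Adj (x t) (x (t + 1))) (t k : ℕ) :
    G.dist (x t) (x (t + k)) ≤ k := by
  induction k with
  | zero => simp
  | succ k ih =>
    exact (dist_le_dist_add_one_of_adj _ (hx (t + k))).trans (Nat.add_le_add_right ih 1)

/-- The distance of the robber after `m` moves from his starting vertex. If `m` is the length of
Stage 1 and he is still free then, this is the length of Stage 2. -/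
noncomputable def stage1Drift (G : SimpleGraph V) (x : ℕ → V) (m : ℕ) : ℕ :=
  G.dist (x 0) (x m)

/-- The distance that the robber covers in Stage 2, if `m` is the length of Stage 1 and he is still
free at the end of Stage 2. This is the distance of the players when Stage 3 begins. -/
noncomputable def stage2Drift (G : SimpleGraph V) (x : ℕ → V) (m : ℕ) : ℕ :=
  G.dist (x m) (x (m + stage1Drift G x m))

theorem stage1End_le_stage2End : stage1End G x y ≤ stage2End G x y := Nat.le_add_right _ _

theorem FollowsFourStages.cop_stage1End (hG : G.Connected) (h : FollowsFourStages G x y)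
    (hf : FreeAt x y (stage1End G x y)) : y (stage1End G x y) = x 0 := by
  have hdist := dist_add_eq_of_stepsToward (a := 0) (m := stage1End G x y) fun t _ ht =>
    h.stage1 t (hf.mono (by omega)) (by omega)
  rw [zero_add] at hdist
  unfold stage1End at hdist ⊢
  exact hG.dist_eq_zero_iff.1 (by omega)

theorem FollowsFourStages.cop_stage2End (hG : G.Connected) (h : FollowsFourStages G x y)
    (hf : FreeAt x y (stage2End G x y)) : y (stage2End G x y) = x (stage1End G x y) := by
  have hdist := dist_add_eq_of_stepsToward (a := stage1End G x y)
    (m := G.dist (y (stage1End G x y)) (x (stage1End G x y))) fun t hat htm =>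
      h.stage2 t (hf.mono htm.le) hat htm
  exact hG.dist_eq_zero_iff.1 (by unfold stage2End; omega)

theorem FollowsFourStages.stage2End_eq (hG : G.Connected) (h : FollowsFourStages G x y)
    (hf : FreeAt x y (stage1End G x y)) :
    stage2End G x y = stage1End G x y + stage1Drift G x (stage1End G x y) := by
  rw [stage2End, h.cop_stage1End hG hf, stage1Drift]

theorem FollowsFourStages.dist_stage2End (hG : G.Connected) (h : FollowsFourStages G x y)
    (hf : FreeAt x y (stage2End G x y)) :
    G.dist (y (stage2End G x y)) (x (stage2End G x y)) = stage2Drift G x (stage1End G x y) := by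
  rw [h.cop_stage2End hG hf, h.stage2End_eq hG (hf.mono stage1End_le_stage2End), stage2Drift]

end Stages

section StageThree

variable {V : Type*} {G : SimpleGraph V} {x y : ℕ → V}

/-- The robber is free after `t` moves and the cop is about to choose a new target in Stage 3. -/
def RetargetsAt (G : SimpleGraph V) (x y : ℕ → V) (t : ℕ) : Prop :=
  FreeAt x y t ∧ stage2End G x y ≤ t ∧ 4 ∣ t - stage2End G x y ∧ StillRetargeting G x y t

/-- The cop retargets after `t` moves, and the robber's next four moves take him to distance at most
`3`, so that the cop gains on him in this block of Stage 3 (if he survives it). -/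
def GainsAt (G : SimpleGraph V) (x y : ℕ → V) (t : ℕ) : Prop :=
  RetargetsAt G x y t ∧ G.dist (x t) (x (t + 4)) ≤ 3

theorem StillRetargeting.mono {s t : ℕ} (h : StillRetargeting G x y t) (hst : s ≤ t) :
    StillRetargeting G x y s :=
  fun i hi => h i (hi.trans hst)

theorem RetargetsAt.four_le_dist {t : ℕ} (h : RetargetsAt G x y t) : 4 ≤ G.dist (y t) (x t) := by
  obtain ⟨_, hle, ⟨i, hi⟩, hstill⟩ := h
  have ht : stage2End G x y + 4 * i = t := by omega
  simpa only [ht] using hstill i ht.le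

theorem RetargetsAt.stillRetargeting_of_lt {t u : ℕ} (h : RetargetsAt G x y t) (hu : u < t + 4) :
    StillRetargeting G x y u := by
  obtain ⟨_, hle, ⟨j, hj⟩, hstill⟩ := h
  exact fun i hi => hstill i (by omega)

theorem RetargetsAt.of_add_four {t : ℕ} (h : RetargetsAt G x y (t + 4))
    (ht : stage2End G x y ≤ t) : RetargetsAt G x y t := by
  obtain ⟨hfree, _, hdvd, hstill⟩ := h
  exact ⟨hfree.mono (by omega), ht, by omega, hstill.mono (by omega)⟩

theorem RetargetsAt.dist_add_four_eq {t : ℕ} (h : RetargetsAt G x y t)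
    (hF : FollowsFourStages G x y) (hf : FreeAt x y (t + 4)) :
    G.dist (y (t + 4)) (x t) + 4 = G.dist (y t) (x t) := by
  refine dist_add_eq_of_stepsToward fun u htu hut => ?_
  have hstep := hF.stage3 u (hf.mono hut.le) (h.2.1.trans htu) (h.stillRetargeting_of_lt hut)
  obtain ⟨_, hle, hdvd, _⟩ := h
  have htarget : stage2End G x y + 4 * ((u - stage2End G x y) / 4) = t := by omega
  rwa [htarget] at hstep

open scoped Classical in
theorem RetargetsAt.dist_add_count_gainsAt_le (hG : G.Connected) (hF : FollowsFourStages G x y)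
    (hx : ∀ t, G.Adj (x t) (x (t + 1))) {k : ℕ}
    (h : RetargetsAt G x y (stage2End G x y + 4 * k)) :
    G.dist (y (stage2End G x y + 4 * k)) (x (stage2End G x y + 4 * k)) +
        Nat.count (fun i => GainsAt G x y (stage2End G x y + 4 * i)) k ≤
      G.dist (y (stage2End G x y)) (x (stage2End G x y)) := by
  induction k with
  | zero => simp
  | succ k ih =>
    set t := stage2End G x y + 4 * k with ht
    have hsucc : stage2End G x y + 4 * (k + 1) = t + 4 := by omega
    rw [hsucc] at h ⊢
    have hprev : RetargetsAt G x y t := h.of_add_four (by omega)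
    have hcop := hprev.dist_add_four_eq hF h.1
    have hrobber := dist_add_le_of_adj_succ hx t 4
    have htriangle := hG.dist_triangle (u := y (t + 4)) (v := x t) (w := x (t + 4))
    have hgain : GainsAt G x y t ↔ G.dist (x t) (x (t + 4)) ≤ 3 := and_iff_right hprev
    have hprev_bound := ih hprev
    rw [Nat.count_succ]
    simp only [← ht, hgain]
    split_ifs <;> omega

open scoped Classical in
theorem FollowsFourStages.count_gainsAt_block_le (hG : G.Connected)
    (hF : FollowsFourStages G x y) (hx : ∀ t, G.Adj (x t) (x (t + 1))) (k : ℕ) :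
    Nat.count (fun i => GainsAt G x y (stage2End G x y + 4 * i)) k ≤
      G.dist (y (stage2End G x y)) (x (stage2End G x y)) := by
  induction k with
  | zero => simp
  | succ k ih =>
    rw [Nat.count_succ]
    split_ifs with hgain
    · have hbound := hgain.1.dist_add_count_gainsAt_le hG hF hx
      have := hgain.1.four_le_dist
      omega
    · exact ih

open scoped Classical in
theorem FollowsFourStages.count_gainsAt_le (hG : G.Connected) (hF : FollowsFourStages G x y)
    (hx : ∀ t, G.Adj (x t) (x (t + 1))) (N : ℕ) :
    Nat.count (GainsAt G x y) N ≤ stage2Drift G x (stage1End G x y) := by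
  rw [Nat.count_eq_card_filter_range]
  set gains := (Finset.range N).filter (GainsAt G x y)
  obtain hempty | ⟨t₀, ht₀⟩ := gains.eq_empty_or_nonempty
  · simp [hempty]
  have hfree : FreeAt x y (stage2End G x y) :=
    have hgain : GainsAt G x y t₀ := (Finset.mem_filter.1 ht₀).2
    hgain.1.1.mono hgain.1.2.1
  have hblocks : gains ⊆ ((Finset.range N).filter fun i =>
      GainsAt G x y (stage2End G x y + 4 * i)).image fun i => stage2End G x y + 4 * i := by
    intro t ht
    obtain ⟨htN, hgain⟩ := Finset.mem_filter.1 ht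
    obtain ⟨i, hi⟩ := hgain.1.2.2.1
    have hti : stage2End G x y + 4 * i = t := by have := hgain.1.2.1; omega
    refine Finset.mem_image.2 ⟨i, Finset.mem_filter.2 ⟨?_, by rwa [hti]⟩, hti⟩
    rw [Finset.mem_range] at htN ⊢
    omega
  calc gains.card
      ≤ Nat.count (fun i => GainsAt G x y (stage2End G x y + 4 * i)) N := by
        rw [Nat.count_eq_card_filter_range]
        exact (Finset.card_le_card hblocks).trans Finset.card_image_le
    _ ≤ G.dist (y (stage2End G x y)) (x (stage2End G x y)) := hF.count_gainsAt_block_le hG hx N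
    _ = _ := hF.dist_stage2End hG hfree

end StageThree

section StageFour

variable {V : Type*} {G : SimpleGraph V} {x y : ℕ → V}

/-- Stage 4 has begun when it is the cop's turn after `t` moves. -/
def InStageFour (G : SimpleGraph V) (x y : ℕ → V) (t : ℕ) : Prop :=
  stage2End G x y ≤ t ∧ ¬ StillRetargeting G x y t

/-- The cop's move `t + 1` is in Stage 4 and does not catch the robber. -/
def SurvivesGreedyAt (G : SimpleGraph V) (x y : ℕ → V) (t : ℕ) : Prop :=
  FreeAt x y t ∧ InStageFour G x y t ∧ y (t + 1) ≠ x t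

theorem InStageFour.mono {s t : ℕ} (h : InStageFour G x y s) (hst : s ≤ t) : InStageFour G x y t :=
  ⟨h.1.trans hst, fun ht => h.2 (ht.mono hst)⟩

theorem FollowsFourStages.dist_add_one_le_of_inStageFour (hG : G.Connected)
    (hF : FollowsFourStages G x y) {t : ℕ} (hf : FreeAt x y t) (h4 : InStageFour G x y t) :
    G.dist (y (t + 1)) (x t) + 1 ≤ G.dist (y t) (x t) :=
  (hF.stage4 t hf h4.1 h4.2).dist_add_one_le hG hf.ne.symm

theorem FollowsFourStages.dist_le_three (hG : G.Connected) (hF : FollowsFourStages G x y)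
    (hx : ∀ t, G.Adj (x t) (x (t + 1))) {t : ℕ} (hf : FreeAt x y t) (h4 : InStageFour G x y t) :
    G.dist (y t) (x t) ≤ 3 := by
  obtain ⟨i, hit, hclose⟩ : ∃ i, stage2End G x y + 4 * i ≤ t ∧
      G.dist (y (stage2End G x y + 4 * i)) (x (stage2End G x y + 4 * i)) < 4 := by
    simpa only [StillRetargeting, not_forall, not_le, exists_prop] using h4.2
  set u := stage2End G x y + 4 * i
  have h4u : InStageFour G x y u := ⟨by omega, fun h => absurd (h i le_rfl) (not_le.2 hclose)⟩
  clear h4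
  induction t, hit using Nat.le_induction with
  | base => omega
  | succ t hut ih =>
    have hft : FreeAt x y t := hf.mono t.le_succ
    have hprev := ih hft
    have hcop := hF.dist_add_one_le_of_inStageFour hG hft (h4u.mono hut)
    have hrobber := dist_le_dist_add_one_of_adj (y (t + 1)) (hx t)
    omega

theorem SurvivesGreedyAt.exists_adj_dist_le_one (hG : G.Connected) (hF : FollowsFourStages G x y)
    (hx : ∀ t, G.Adj (x t) (x (t + 1))) {t : ℕ} (h : SurvivesGreedyAt G x y t) :
    ∃ b, G.Adj (x t) b ∧ G.dist (y (t + 1)) b ≤ 1 := by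
  obtain ⟨hf, h4, hne⟩ := h
  have hthree := hF.dist_le_three hG hx hf h4
  have hcop := hF.dist_add_one_le_of_inStageFour hG hf h4
  obtain ⟨b, hadj, hb⟩ := exists_adj_dist_add_one_eq hG hne.symm
  refine ⟨b, hadj, ?_⟩
  rw [G.dist_comm (u := x t), G.dist_comm (u := b)] at hb
  omega

theorem SurvivesGreedyAt.cop_add_two_eq (hG : G.Connected) (hF : FollowsFourStages G x y)
    {t : ℕ} (h : SurvivesGreedyAt G x y t) (hnear : G.dist (y (t + 1)) (x (t + 1)) ≤ 1)
    (hf : FreeAt x y (t + 1)) : y (t + 2) = x (t + 1) := by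
  have hcop : G.dist (y (t + 2)) (x (t + 1)) + 1 ≤ _ :=
    hF.dist_add_one_le_of_inStageFour hG hf (h.2.1.mono t.le_succ)
  exact hG.dist_eq_zero_iff.1 (by omega)

open scoped Classical in
theorem FollowsFourStages.count_survivesGreedyAt_near_le_one (hG : G.Connected)
    (hF : FollowsFourStages G x y) (N : ℕ) :
    Nat.count (fun t => SurvivesGreedyAt G x y t ∧ G.dist (y (t + 1)) (x (t + 1)) ≤ 1) N ≤ 1 := by
  refine count_le_one (fun _ t hst ⟨hs, hnear⟩ ⟨ht, _⟩ => ?_) N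
  have hcaught := hs.cop_add_two_eq hG hF hnear (ht.1.mono hst)
  obtain rfl | hlt := eq_or_lt_of_le (Nat.succ_le_of_lt hst)
  · exact ht.2.2 hcaught
  · exact (ht.1.mono hlt).ne_of_succ hcaught

end StageFour

section CaptureCount

variable {V : Type*} {G : SimpleGraph V} {x y : ℕ → V}

theorem FollowsFourStages.stage_cases (hG : G.Connected) (hF : FollowsFourStages G x y) {t : ℕ}
    (hf : FreeAt x y t) :
    t < stage1End G x y + stage1Drift G x (stage1End G x y) ∨
      (∃ u, RetargetsAt G x y u ∧ u ≤ t ∧ t < u + 4) ∨ SurvivesGreedyAt G x y t ∨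
      y (t + 1) = x t := by
  by_cases hearly : t < stage1End G x y + stage1Drift G x (stage1End G x y)
  · exact Or.inl hearly
  have hs : stage2End G x y ≤ t := by
    rw [hF.stage2End_eq hG (hf.mono (by omega))]
    omega
  by_cases hstill : StillRetargeting G x y t
  · set j := (t - stage2End G x y) % 4
    exact Or.inr (Or.inl ⟨t - j, ⟨hf.mono (by omega), by omega, by omega,
      hstill.mono (by omega)⟩, by omega, by omega⟩)
  · by_cases hcaught : y (t + 1) = x t
    · exact Or.inr (Or.inr (Or.inr hcaught))
    · exact Or.inr (Or.inr (Or.inl ⟨hf, ⟨hs, hstill⟩, hcaught⟩))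

open scoped Classical in
theorem count_freeAt_and_caught_le_one (x y : ℕ → V) (N : ℕ) :
    Nat.count (fun t => FreeAt x y t ∧ y (t + 1) = x t) N ≤ 1 :=
  count_le_one (fun _ _ hst hs ht => (ht.1.mono hst).ne_of_succ hs.2) N

open scoped Classical in
theorem FollowsFourStages.count_freeAt_le (hG : G.Connected) (hF : FollowsFourStages G x y)
    (N : ℕ) :
    Nat.count (FreeAt x y) N ≤ stage1End G x y + stage1Drift G x (stage1End G x y) +
      Nat.count (RetargetsAt G x y) N * 4 + Nat.count (SurvivesGreedyAt G x y) N + 1 := by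
  set m := stage1End G x y
  have hcaught := count_freeAt_and_caught_le_one x y N
  simp only [Nat.count_eq_card_filter_range] at hcaught ⊢
  set retargets := (Finset.range N).filter (RetargetsAt G x y)
  set survives := (Finset.range N).filter (SurvivesGreedyAt G x y)
  set caught := (Finset.range N).filter fun t => FreeAt x y t ∧ y (t + 1) = x t
  have hcover : (Finset.range N).filter (FreeAt x y) ⊆
      Finset.range (m + stage1Drift G x m) ∪ retargets.biUnion (fun u => Finset.Ico u (u + 4)) ∪
        survives ∪ caught := by
    intro t ht
    obtain ⟨htN, hf⟩ := Finset.mem_filter.1 ht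
    simp only [Finset.mem_union, Finset.mem_biUnion, Finset.mem_range, Finset.mem_Ico]
    obtain hearly | ⟨u, hu, hut, htu⟩ | hsurvives | hcaught := hF.stage_cases hG hf
    · exact Or.inl (Or.inl (Or.inl hearly))
    · have huN : u ∈ retargets :=
        Finset.mem_filter.2 ⟨Finset.mem_range.2 (hut.trans_lt (Finset.mem_range.1 htN)), hu⟩
      exact Or.inl (Or.inl (Or.inr ⟨u, huN, hut, htu⟩))
    · exact Or.inl (Or.inr (Finset.mem_filter.2 ⟨htN, hsurvives⟩))
    · exact Or.inr (Finset.mem_filter.2 ⟨htN, hf, hcaught⟩)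
  have hblocks : (retargets.biUnion fun u => Finset.Ico u (u + 4)).card ≤ retargets.card * 4 :=
    Finset.card_biUnion_le_card_mul _ _ _ fun u _ => by simp
  calc ((Finset.range N).filter (FreeAt x y)).card
      ≤ _ := Finset.card_le_card hcover
    _ ≤ (Finset.range (m + stage1Drift G x m)).card +
          (retargets.biUnion fun u => Finset.Ico u (u + 4)).card + survives.card + caught.card := by
        grw [Finset.card_union_le, Finset.card_union_le, Finset.card_union_le]
    _ ≤ m + stage1Drift G x m + retargets.card * 4 + survives.card + 1 := by
        rw [Finset.card_range]
        omega

end CaptureCount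

section Determined

variable {V Ω β γ δ : Type*} {X Y : ℕ → Ω → V} {t : ℕ}

/-- The robber's first `t` moves and the cop's first `t + 1` moves are the same in two plays. -/
def AgreeUntil (t : ℕ) (x y x' y' : ℕ → V) : Prop :=
  (∀ s ≤ t, x s = x' s) ∧ ∀ s ≤ t + 1, y s = y' s

/-- `F` is a function of the robber's first `t` moves and of the cop's first `t + 1` moves, that is,
of all that has happened just before the robber's step in move `t + 1`. -/
def DeterminedAt (X Y : ℕ → Ω → V) (t : ℕ) (F : Ω → β) : Prop :=
  ∀ ω ω', AgreeUntil t (X · ω) (Y · ω) (X · ω') (Y · ω') → F ω = F ω'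

theorem AgreeUntil.symm {x y x' y' : ℕ → V} (h : AgreeUntil t x y x' y') :
    AgreeUntil t x' y' x y :=
  ⟨fun s hs => (h.1 s hs).symm, fun s hs => (h.2 s hs).symm⟩

theorem DeterminedAt.mono {F : Ω → β} (h : DeterminedAt X Y t F) {u : ℕ} (htu : t ≤ u) :
    DeterminedAt X Y u F := fun ω ω' hω =>
  h ω ω' ⟨fun s hs => hω.1 s (hs.trans htu), fun s hs => hω.2 s (by omega)⟩

theorem DeterminedAt.comp {F : Ω → β} (h : DeterminedAt X Y t F) (g : β → γ) :
    DeterminedAt X Y t fun ω => g (F ω) :=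
  fun ω ω' hω => congrArg g (h ω ω' hω)

theorem DeterminedAt.comp₂ {F : Ω → β} {F' : Ω → γ} (h : DeterminedAt X Y t F)
    (h' : DeterminedAt X Y t F') (g : β → γ → δ) : DeterminedAt X Y t fun ω => g (F ω) (F' ω) :=
  fun ω ω' hω => congrArg₂ g (h ω ω' hω) (h' ω ω' hω)

theorem determinedAt_robber {s : ℕ} (hst : s ≤ t) : DeterminedAt X Y t (X s) :=
  fun _ _ hω => hω.1 s hst

theorem determinedAt_cop {s : ℕ} (hst : s ≤ t + 1) : DeterminedAt X Y t (Y s) :=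
  fun _ _ hω => hω.2 s hst

theorem determinedAt_of_imp {p : (ℕ → V) → (ℕ → V) → Prop}
    (hp : ∀ {x y x' y'}, AgreeUntil t x y x' y' → p x y → p x' y') :
    DeterminedAt X Y t fun ω => p (X · ω) (Y · ω) :=
  fun _ _ hω => propext ⟨hp hω, hp hω.symm⟩

end Determined

section DeterminedStages

variable {V : Type*} {G : SimpleGraph V} {x y x' y' : ℕ → V} {t : ℕ}

theorem FreeAt.congr (hxy : AgreeUntil t x y x' y') (h : FreeAt x y t) : FreeAt x' y' t := by
  rintro s hs (hcaught | ⟨u, rfl, hcaught⟩)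
  · exact h s hs (Or.inl (by rw [hxy.1 s hs, hxy.2 s (by omega), hcaught]))
  · exact h _ hs (Or.inr ⟨u, rfl, by rw [hxy.1 u (by omega), hxy.2 _ (by omega), hcaught]⟩)

theorem stage2End_congr (hxy : AgreeUntil t x y x' y') (h : stage2End G x y ≤ t) :
    stage2End G x' y' = stage2End G x y := by
  have hle : stage1End G x y ≤ t := stage1End_le_stage2End.trans h
  have hstage1 : stage1End G x' y' = stage1End G x y := by
    rw [stage1End, stage1End, hxy.1 0 (by omega), hxy.2 0 (by omega)]
  rw [stage2End, stage2End, hstage1, hxy.1 _ hle, hxy.2 _ (by omega)]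

theorem StillRetargeting.congr (hxy : AgreeUntil t x y x' y') (hle : stage2End G x y ≤ t)
    (h : StillRetargeting G x y t) : StillRetargeting G x' y' t := by
  intro i hi
  rw [stage2End_congr hxy hle] at hi ⊢
  rw [← hxy.1 _ hi, ← hxy.2 _ (by omega)]
  exact h i hi

theorem RetargetsAt.congr (hxy : AgreeUntil t x y x' y') (h : RetargetsAt G x y t) :
    RetargetsAt G x' y' t := by
  obtain ⟨hfree, hle, hdvd, hstill⟩ := h
  have hend := stage2End_congr hxy hle
  exact ⟨hfree.congr hxy, hend ▸ hle, hend ▸ hdvd, hstill.congr hxy hle⟩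

theorem InStageFour.congr (hxy : AgreeUntil t x y x' y') (h : InStageFour G x y t) :
    InStageFour G x' y' t := by
  have hle := (stage2End_congr hxy h.1).trans_le h.1
  exact ⟨hle, fun hstill => h.2 (hstill.congr hxy.symm hle)⟩

theorem SurvivesGreedyAt.congr (hxy : AgreeUntil t x y x' y') (h : SurvivesGreedyAt G x y t) :
    SurvivesGreedyAt G x' y' t := by
  obtain ⟨hfree, h4, hne⟩ := h
  refine ⟨hfree.congr hxy, h4.congr hxy, ?_⟩
  rwa [← hxy.1 t le_rfl, ← hxy.2 _ le_rfl]

variable {Ω : Type*} {X Y : ℕ → Ω → V}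

theorem determinedAt_freeAt (t : ℕ) : DeterminedAt X Y t fun ω => FreeAt (X · ω) (Y · ω) t :=
  determinedAt_of_imp FreeAt.congr

theorem determinedAt_retargetsAt (t : ℕ) :
    DeterminedAt X Y t fun ω => RetargetsAt G (X · ω) (Y · ω) t :=
  determinedAt_of_imp RetargetsAt.congr

theorem determinedAt_gainsAt (t : ℕ) :
    DeterminedAt X Y (t + 4) fun ω => GainsAt G (X · ω) (Y · ω) t :=
  ((determinedAt_retargetsAt t).mono (by omega)).comp₂
    ((determinedAt_robber (s := t) (by omega)).comp₂ (determinedAt_robber le_rfl)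
      fun a b => G.dist a b ≤ 3) And

theorem determinedAt_survivesGreedyAt (t : ℕ) :
    DeterminedAt X Y t fun ω => SurvivesGreedyAt G (X · ω) (Y · ω) t :=
  determinedAt_of_imp SurvivesGreedyAt.congr

theorem determinedAt_stage1Drift (m : ℕ) :
    DeterminedAt X Y m fun ω => stage1Drift G (X · ω) m :=
  (determinedAt_robber (Nat.zero_le m)).comp₂ (determinedAt_robber le_rfl) G.dist

end DeterminedStages

section Lintegral

variable {Ω : Type*}

theorem lintegral_eq_tsum_fiber [MeasurableSpace Ω] (μ : Measure Ω) {ι : Type*} [Countable ι]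
    {τ : Ω → ι} (hτ : ∀ i, MeasurableSet (τ ⁻¹' {i})) (f : Ω → ℝ≥0∞) :
    ∫⁻ ω, f ω ∂μ = ∑' i, ∫⁻ ω in τ ⁻¹' {i}, f ω ∂μ := by
  rw [← lintegral_iUnion hτ (pairwise_disjoint_fiber τ), ← Set.preimage_iUnion,
    Set.iUnion_of_singleton, Set.preimage_univ, Measure.restrict_univ]

variable {p : ℕ → Ω → Prop}

open scoped Classical in
theorem natCast_count_eq_sum_indicator (N : ℕ) (ω : Ω) :
    (Nat.count (p · ω) N : ℝ≥0∞) = ∑ t ∈ Finset.range N, {ω | p t ω}.indicator 1 ω := by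
  rw [Nat.count_eq_card_filter_range, Finset.card_filter, Nat.cast_sum]
  simp [Set.indicator_apply]

open scoped Classical in
theorem measurable_count [MeasurableSpace Ω] (hp : ∀ t, MeasurableSet {ω | p t ω}) (N : ℕ) :
    Measurable fun ω => (Nat.count (p · ω) N : ℝ≥0∞) := by
  simp only [natCast_count_eq_sum_indicator]
  exact Finset.measurable_fun_sum _ fun t _ => measurable_one.indicator (hp t)

open scoped Classical in
theorem lintegral_count [MeasurableSpace Ω] (μ : Measure Ω)
    (hp : ∀ t, MeasurableSet {ω | p t ω}) (N : ℕ) :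
    ∫⁻ ω, (Nat.count (p · ω) N : ℝ≥0∞) ∂μ = ∑ t ∈ Finset.range N, μ {ω | p t ω} := by
  simp only [natCast_count_eq_sum_indicator]
  rw [lintegral_finsetSum _ fun t _ => measurable_one.indicator (hp t)]
  exact Finset.sum_congr rfl fun t _ => lintegral_indicator_one (hp t)

end Lintegral

section History

variable {V Ω : Type*} {X Y : ℕ → Ω → V} {t : ℕ}

/-- The positions that make up `history`, as a map that takes finitely many values. -/
def historyMap (X Y : ℕ → Ω → V) (t : ℕ) (ω : Ω) : (Fin (t + 1) → V) × (Fin (t + 2) → V) :=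
  (fun i => X i ω, fun i => Y i ω)

theorem historyMap_eq_iff {ω ω' : Ω} :
    historyMap X Y t ω = historyMap X Y t ω' ↔ ω ∈ history X Y t (X · ω') (Y · ω') := by
  simp only [historyMap, Prod.mk.injEq, funext_iff, Fin.forall_iff, history, Set.mem_ofPred_eq,
    Nat.lt_succ_iff]

theorem historyMap_preimage_singleton (ω : Ω) :
    historyMap X Y t ⁻¹' {historyMap X Y t ω} = history X Y t (X · ω) (Y · ω) :=
  Set.ext fun _ => historyMap_eq_iff

theorem measurableSet_historyMap_preimage [MeasurableSpace Ω]
    (hX : ∀ t a, MeasurableSet {ω | X t ω = a}) (hY : ∀ t a, MeasurableSet {ω | Y t ω = a})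
    (a : (Fin (t + 1) → V) × (Fin (t + 2) → V)) : MeasurableSet (historyMap X Y t ⁻¹' {a}) := by
  have hpreimage : historyMap X Y t ⁻¹' {a} =
      (⋂ i : Fin (t + 1), {ω | X i ω = a.1 i}) ∩ ⋂ i : Fin (t + 2), {ω | Y i ω = a.2 i} := by
    ext ω
    simp [historyMap, Prod.ext_iff, funext_iff]
  rw [hpreimage]
  exact (MeasurableSet.iInter fun i => hX _ _).inter (MeasurableSet.iInter fun i => hY _ _)

theorem sum_stepProb_mul_ofReal [Fintype V] {G : SimpleGraph V} [DecidableRel G.Adj] {f : V → ℝ}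
    (hf : ∀ b, 0 ≤ f b) (a : V) :
    ∑ b, stepProb G a b * ENNReal.ofReal (f b) = ENNReal.ofReal (walkAvg G f a) := by
  have hneighbor : Finset.univ.filter (G.Adj a) = G.neighborFinset a := by ext; simp
  simp only [stepProb, ite_mul, zero_mul]
  rw [← Finset.sum_filter, ← Finset.mul_sum, ← ENNReal.ofReal_sum_of_nonneg fun b _ => hf b,
    hneighbor, walkAvg]
  obtain hzero | hpos := (G.degree a).eq_zero_or_pos
  · have hempty : G.neighborFinset a = ∅ := Finset.card_eq_zero.1 hzero
    simp [hempty]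
  · rw [ENNReal.ofReal_div_of_pos (by exact_mod_cast hpos), ENNReal.div_eq_inv_mul,
      ENNReal.ofReal_natCast]

end History

namespace IsDrunkGame

variable {V Ω : Type*} [Fintype V] {G : SimpleGraph V} [DecidableRel G.Adj] [MeasurableSpace Ω]
  {P : Measure Ω} {X Y : ℕ → Ω → V} {r c : V}

theorem measurableSet_of_determinedAt (h : IsDrunkGame G P X Y r c) {t : ℕ} {A : Ω → Prop}
    (hA : DeterminedAt X Y t A) : MeasurableSet {ω | A ω} := by
  have hfibers : {ω | A ω} = ⋃ a ∈ historyMap X Y t '' {ω | A ω}, historyMap X Y t ⁻¹' {a} := by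
    refine Set.Subset.antisymm (fun ω hω => Set.mem_biUnion (Set.mem_image_of_mem _ hω) rfl) ?_
    simp only [Set.biUnion_image, Set.iUnion_subset_iff]
    exact fun ω hω ω' hω' => (hA ω' ω (historyMap_eq_iff.1 hω')).mpr hω
  rw [hfibers]
  exact (Set.toFinite _).measurableSet_biUnion fun a _ =>
    measurableSet_historyMap_preimage h.measurable_robber h.measurable_cop a

theorem setLIntegral_history_robber_step (h : IsDrunkGame G P X Y r c) (t : ℕ) (x y : ℕ → V)
    (f : V → ℝ≥0∞) :
    ∫⁻ ω in history X Y t x y, f (X (t + 1) ω) ∂P =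
      ∫⁻ _ in history X Y t x y, ∑ b, stepProb G (x t) b * f b ∂P := by
  have hm : ∀ b, MeasurableSet (X (t + 1) ⁻¹' {b}) := h.measurable_robber (t + 1)
  have hfiber : ∀ b, ∫⁻ ω in X (t + 1) ⁻¹' {b}, f (X (t + 1) ω) ∂(P.restrict (history X Y t x y)) =
      stepProb G (x t) b * f b * P (history X Y t x y) := by
    intro b
    rw [setLIntegral_congr_fun (hm b) (g := fun _ => f b) fun ω hω => congrArg f hω,
      setLIntegral_const, Measure.restrict_apply (hm b), Set.inter_comm]
    refine (congrArg (f b * ·) (h.robber_step t x y b)).trans ?_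
    ring
  rw [lintegral_eq_tsum_fiber _ hm, tsum_congr hfiber, tsum_fintype, setLIntegral_const,
    Finset.sum_mul]

theorem setLIntegral_robber_step (h : IsDrunkGame G P X Y r c) {t : ℕ} {A : Ω → Prop}
    (hA : DeterminedAt X Y t A) {F : Ω → V → ℝ} (hF : DeterminedAt X Y t F)
    (hF0 : ∀ ω b, 0 ≤ F ω b) :
    ∫⁻ ω in {ω | A ω}, ENNReal.ofReal (F ω (X (t + 1) ω)) ∂P =
      ∫⁻ ω in {ω | A ω}, ENNReal.ofReal (walkAvg G (F ω) (X t ω)) ∂P := by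
  have hm := measurableSet_historyMap_preimage (t := t) h.measurable_robber h.measurable_cop
  rw [lintegral_eq_tsum_fiber _ hm, lintegral_eq_tsum_fiber _ hm]
  refine tsum_congr fun a => ?_
  rw [Measure.restrict_restrict (hm a)]
  obtain hempty | ⟨ω₀, hω₀, hAω₀⟩ :=
    (historyMap X Y t ⁻¹' {a} ∩ {ω | A ω}).eq_empty_or_nonempty
  · simp only [hempty, Measure.restrict_empty, lintegral_zero_measure]
  obtain rfl : historyMap X Y t ω₀ = a := hω₀
  have hagree : ∀ ω ∈ history X Y t (X · ω₀) (Y · ω₀),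
      AgreeUntil t (X · ω) (Y · ω) (X · ω₀) (Y · ω₀) := fun ω hω => hω
  have hsub : history X Y t (X · ω₀) (Y · ω₀) ⊆ {ω | A ω} :=
    fun ω hω => (hA ω ω₀ (hagree ω hω)).mpr hAω₀
  have hmh := hm (historyMap X Y t ω₀)
  rw [historyMap_preimage_singleton] at hmh ⊢
  rw [Set.inter_eq_self_of_subset_left hsub]
  calc ∫⁻ ω in history X Y t (X · ω₀) (Y · ω₀), ENNReal.ofReal (F ω (X (t + 1) ω)) ∂P
      = ∫⁻ ω in history X Y t (X · ω₀) (Y · ω₀), ENNReal.ofReal (F ω₀ (X (t + 1) ω)) ∂P :=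
        setLIntegral_congr_fun hmh fun ω hω => by rw [hF ω ω₀ (hagree ω hω)]
    _ = ∫⁻ _ in history X Y t (X · ω₀) (Y · ω₀), ENNReal.ofReal (walkAvg G (F ω₀) (X t ω₀)) ∂P := by
        rw [h.setLIntegral_history_robber_step t _ _ fun b => ENNReal.ofReal (F ω₀ b),
          sum_stepProb_mul_ofReal (hF0 ω₀)]
    _ = _ := setLIntegral_congr_fun hmh fun ω hω => by
        have hX : X t ω = X t ω₀ := (hagree ω hω).1 t le_rfl
        rw [hF ω ω₀ (hagree ω hω), hX]

theorem setLIntegral_robber_steps (h : IsDrunkGame G P X Y r c) {t : ℕ} (k : ℕ) {A : Ω → Prop}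
    (hA : DeterminedAt X Y t A) {F : Ω → V → ℝ} (hF : DeterminedAt X Y t F)
    (hF0 : ∀ ω b, 0 ≤ F ω b) :
    ∫⁻ ω in {ω | A ω}, ENNReal.ofReal (F ω (X (t + k) ω)) ∂P =
      ∫⁻ ω in {ω | A ω}, ENNReal.ofReal ((walkAvg G)^[k] (F ω) (X t ω)) ∂P := by
  induction k generalizing F with
  | zero => rfl
  | succ k ih =>
    rw [← add_assoc, h.setLIntegral_robber_step (hA.mono (by omega)) (hF.mono (by omega)) hF0]
    exact ih (F := fun ω => walkAvg G (F ω)) (hF.comp (walkAvg G))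
      fun ω b => walkAvg_nonneg fun _ _ => hF0 ω _

theorem lintegral_robber_steps (h : IsDrunkGame G P X Y r c) {t : ℕ} {τ : Ω → ℕ}
    (hτ : DeterminedAt X Y t τ) {F : Ω → V → ℝ} (hF : DeterminedAt X Y t F)
    (hF0 : ∀ ω b, 0 ≤ F ω b) :
    ∫⁻ ω, ENNReal.ofReal (F ω (X (t + τ ω) ω)) ∂P =
      ∫⁻ ω, ENNReal.ofReal ((walkAvg G)^[τ ω] (F ω) (X t ω)) ∂P := by
  have hdet : ∀ k, DeterminedAt X Y t fun ω => τ ω = k := fun k => hτ.comp (· = k)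
  have hm : ∀ k, MeasurableSet (τ ⁻¹' {k}) := fun k => h.measurableSet_of_determinedAt (hdet k)
  rw [lintegral_eq_tsum_fiber P hm, lintegral_eq_tsum_fiber P hm]
  refine tsum_congr fun k => ?_
  calc ∫⁻ ω in τ ⁻¹' {k}, ENNReal.ofReal (F ω (X (t + τ ω) ω)) ∂P
      = ∫⁻ ω in τ ⁻¹' {k}, ENNReal.ofReal (F ω (X (t + k) ω)) ∂P :=
        setLIntegral_congr_fun (hm k) fun ω (hω : τ ω = k) => by rw [hω]
    _ = ∫⁻ ω in τ ⁻¹' {k}, ENNReal.ofReal ((walkAvg G)^[k] (F ω) (X t ω)) ∂P :=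
        h.setLIntegral_robber_steps k (hdet k) hF hF0
    _ = _ := setLIntegral_congr_fun (hm k) fun ω (hω : τ ω = k) => by rw [hω]

theorem ae_adj (h : IsDrunkGame G P X Y r c) : ∀ᵐ ω ∂P, ∀ t, G.Adj (X t ω) (X (t + 1) ω) := by
  classical
  refine ae_all_iff.2 fun t => ?_
  set F : Ω → V → ℝ := fun ω => {b | ¬ G.Adj (X t ω) b}.indicator 1
  have hF : DeterminedAt X Y t F :=
    (determinedAt_robber le_rfl).comp fun a => {b | ¬ G.Adj a b}.indicator (1 : V → ℝ)
  have hF0 : ∀ ω b, 0 ≤ F ω b := fun ω => Set.indicator_nonneg fun _ _ => zero_le_one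
  have hm : MeasurableSet {ω | ¬ G.Adj (X t ω) (X (t + 1) ω)} :=
    h.measurableSet_of_determinedAt (t := t + 1)
      ((determinedAt_robber (by omega)).comp₂ (determinedAt_robber le_rfl) fun a b => ¬ G.Adj a b)
  have hzero : ∀ ω, walkAvg G (F ω) (X t ω) = 0 := fun ω => by
    have hsum : ∀ b ∈ G.neighborFinset (X t ω), F ω b = 0 := fun b hb =>
      Set.indicator_of_notMem (not_not.2 ((G.mem_neighborFinset _ _).1 hb)) _
    rw [walkAvg, Finset.sum_eq_zero hsum, zero_div]
  calc P {ω | ¬ G.Adj (X t ω) (X (t + 1) ω)}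
      = ∫⁻ ω, ENNReal.ofReal (F ω (X (t + 1) ω)) ∂P := by
        rw [← lintegral_indicator_one hm]
        refine lintegral_congr fun ω => ?_
        by_cases hω : G.Adj (X t ω) (X (t + 1) ω) <;> simp [F, hω]
    _ = ∫⁻ ω, ENNReal.ofReal (walkAvg G (F ω) (X t ω)) ∂P :=
        h.lintegral_robber_steps (τ := fun _ => 1) (fun _ _ _ => rfl) hF hF0
    _ = 0 := by simp only [hzero, ENNReal.ofReal_zero, lintegral_zero]

theorem ofReal_mul_measure_le (h : IsDrunkGame G P X Y r c) {t : ℕ} (k i : ℕ) {A : Ω → Prop}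
    (hA : DeterminedAt X Y t A) {Z : Ω → V} (hZ : DeterminedAt X Y t Z) {p : ℝ}
    (hp : ∀ᵐ ω ∂P, A ω → p ≤ (walkAvg G)^[k] (ballInd G (Z ω) i) (X t ω)) :
    ENNReal.ofReal p * P {ω | A ω} ≤ P {ω | A ω ∧ G.dist (Z ω) (X (t + k) ω) ≤ i} := by
  have hAm := h.measurableSet_of_determinedAt hA
  have hnear : MeasurableSet {ω | G.dist (Z ω) (X (t + k) ω) ≤ i} :=
    h.measurableSet_of_determinedAt (t := t + k)
      ((hZ.mono (by omega)).comp₂ (determinedAt_robber le_rfl) fun a b => G.dist a b ≤ i)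
  calc ENNReal.ofReal p * P {ω | A ω}
      = ∫⁻ _ in {ω | A ω}, ENNReal.ofReal p ∂P := (setLIntegral_const _ _).symm
    _ ≤ ∫⁻ ω in {ω | A ω}, ENNReal.ofReal ((walkAvg G)^[k] (ballInd G (Z ω) i) (X t ω)) ∂P := by
        refine lintegral_mono_ae ((ae_restrict_iff' hAm).2 ?_)
        filter_upwards [hp] with ω hω hAω using ENNReal.ofReal_le_ofReal (hω hAω)
    _ = ∫⁻ ω in {ω | A ω}, ENNReal.ofReal (ballInd G (Z ω) i (X (t + k) ω)) ∂P :=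
        (h.setLIntegral_robber_steps k hA (hZ.comp fun z => ballInd G z i)
          fun ω => ballInd_nonneg (Z ω) i).symm
    _ = ∫⁻ ω in {ω | A ω}, {ω | G.dist (Z ω) (X (t + k) ω) ≤ i}.indicator 1 ω ∂P := by
        refine lintegral_congr fun ω => ?_
        by_cases hω : G.dist (Z ω) (X (t + k) ω) ≤ i <;> simp [ballInd, hω]
    _ = P {ω | A ω ∧ G.dist (Z ω) (X (t + k) ω) ≤ i} := by
        rw [lintegral_indicator_one hnear, Measure.restrict_apply hnear, Set.inter_comm]
        rfl

theorem lintegral_dist_robber_le (h : IsDrunkGame G P X Y r c) (hdeg : ∀ a, 0 < G.degree a)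
    {t : ℕ} {τ : Ω → ℕ} (hτ : DeterminedAt X Y t τ) :
    ∫⁻ ω, (G.dist (X t ω) (X (t + τ ω) ω) : ℝ≥0∞) ∂P ≤
      ∫⁻ ω, ENNReal.ofReal ((Real.log (Fintype.card V) + 10) * √(τ ω)) ∂P := by
  have hsteps := h.lintegral_robber_steps hτ (F := fun ω b => (G.dist (X t ω) b : ℝ))
    ((determinedAt_robber le_rfl).comp fun a b => (G.dist a b : ℝ)) fun _ _ => Nat.cast_nonneg _
  simp only [ENNReal.ofReal_natCast] at hsteps
  rw [hsteps]
  exact lintegral_mono fun ω => ENNReal.ofReal_le_ofReal (walkAvg_iterate_dist_le hdeg _ _)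

theorem lintegral_stage1Drift_le [IsProbabilityMeasure P] (h : IsDrunkGame G P X Y r c)
    (hdeg : ∀ a, 0 < G.degree a) (m : ℕ) :
    ∫⁻ ω, (stage1Drift G (X · ω) m : ℝ≥0∞) ∂P ≤
      ENNReal.ofReal ((Real.log (Fintype.card V) + 10) * √m) := by
  have hdist := h.lintegral_dist_robber_le hdeg (t := 0) (τ := fun _ => m) fun _ _ _ => rfl
  simpa only [stage1Drift, zero_add, lintegral_const, measure_univ, mul_one] using hdist

theorem lintegral_stage2Drift_le [IsProbabilityMeasure P] (h : IsDrunkGame G P X Y r c)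
    (hdeg : ∀ a, 0 < G.degree a) (m : ℕ) {a : ℝ} (ha : 0 < a) :
    ∫⁻ ω, (stage2Drift G (X · ω) m : ℝ≥0∞) ∂P ≤
      ENNReal.ofReal ((Real.log (Fintype.card V) + 10) *
        (a + (Real.log (Fintype.card V) + 10) * √m / a)) := by
  set L := Real.log (Fintype.card V) + 10
  have hL : 0 ≤ L := add_nonneg (Real.log_natCast_nonneg _) (by norm_num)
  have hsqrt : ∀ u : ℕ, L * √u ≤ L * a + L / a * u := fun u => by
    have hamgm : √u ≤ a + u / a := by
      rw [add_div' _ _ _ ha.ne', le_div_iff₀ ha]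
      nlinarith [Real.sq_sqrt (Nat.cast_nonneg (α := ℝ) u), sq_nonneg (a - √u), sq_nonneg (a + √u)]
    calc L * √u ≤ L * (a + u / a) := mul_le_mul_of_nonneg_left hamgm hL
      _ = L * a + L / a * u := by ring
  calc ∫⁻ ω, (stage2Drift G (X · ω) m : ℝ≥0∞) ∂P
      ≤ ∫⁻ ω, ENNReal.ofReal (L * √(stage1Drift G (X · ω) m)) ∂P :=
        h.lintegral_dist_robber_le hdeg (determinedAt_stage1Drift m)
    _ ≤ ∫⁻ ω, (ENNReal.ofReal (L * a) +
          ENNReal.ofReal (L / a) * (stage1Drift G (X · ω) m : ℝ≥0∞)) ∂P := by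
        refine lintegral_mono fun ω => ?_
        rw [← ENNReal.ofReal_natCast, ← ENNReal.ofReal_mul (by positivity),
          ← ENNReal.ofReal_add (by positivity) (by positivity)]
        exact ENNReal.ofReal_le_ofReal (hsqrt _)
    _ = ENNReal.ofReal (L * a) +
          ENNReal.ofReal (L / a) * ∫⁻ ω, (stage1Drift G (X · ω) m : ℝ≥0∞) ∂P := by
        rw [lintegral_add_left measurable_const, lintegral_const, measure_univ, mul_one,
          lintegral_const_mul' _ _ ENNReal.ofReal_ne_top]
    _ ≤ ENNReal.ofReal (L * a) + ENNReal.ofReal (L / a) * ENNReal.ofReal (L * √m) := by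
        grw [h.lintegral_stage1Drift_le hdeg m]
    _ = ENNReal.ofReal (L * (a + L * √m / a)) := by
        rw [← ENNReal.ofReal_mul (by positivity), ← ENNReal.ofReal_add (by positivity)
          (by positivity)]
        congr 1
        ring

theorem stage1End_eq (h : IsDrunkGame G P X Y r c) (ω : Ω) :
    stage1End G (X · ω) (Y · ω) = G.dist c r := by
  rw [stage1End, h.robber_start, h.cop_start]

theorem ofReal_mul_tsum_measure_retargetsAt_le (h : IsDrunkGame G P X Y r c)
    (hF : ∀ ω, FollowsFourStages G (X · ω) (Y · ω)) (hG : G.Connected) {p : ℝ}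
    (hp : ∀ x, p ≤ (walkAvg G)^[4] (ballInd G x 3) x) :
    ENNReal.ofReal p * ∑' t, P {ω | RetargetsAt G (X · ω) (Y · ω) t} ≤
      ∫⁻ ω, (stage2Drift G (X · ω) (G.dist c r) : ℝ≥0∞) ∂P := by
  classical
  rw [← ENNReal.tsum_mul_left]
  refine ENNReal.tsum_le_of_sum_range_le fun N => ?_
  calc ∑ t ∈ Finset.range N, ENNReal.ofReal p * P {ω | RetargetsAt G (X · ω) (Y · ω) t}
      ≤ ∑ t ∈ Finset.range N, P {ω | GainsAt G (X · ω) (Y · ω) t} :=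
        Finset.sum_le_sum fun t _ => h.ofReal_mul_measure_le 4 3 (determinedAt_retargetsAt t)
          (determinedAt_robber le_rfl) (Eventually.of_forall fun ω _ => hp _)
    _ = ∫⁻ ω, (Nat.count (GainsAt G (X · ω) (Y · ω)) N : ℝ≥0∞) ∂P :=
        (lintegral_count P (fun t => h.measurableSet_of_determinedAt (determinedAt_gainsAt t))
          N).symm
    _ ≤ ∫⁻ ω, (stage2Drift G (X · ω) (G.dist c r) : ℝ≥0∞) ∂P := by
        refine lintegral_mono_ae ?_
        filter_upwards [h.ae_adj] with ω hω
        rw [← h.stage1End_eq ω]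
        exact_mod_cast (hF ω).count_gainsAt_le hG hω N

theorem tsum_measure_survivesGreedyAt_le [IsProbabilityMeasure P] (h : IsDrunkGame G P X Y r c)
    (hF : ∀ ω, FollowsFourStages G (X · ω) (Y · ω)) (hG : G.Connected)
    (hdeg : ∀ a, 0 < G.degree a) :
    ∑' t, P {ω | SurvivesGreedyAt G (X · ω) (Y · ω) t} ≤ G.maxDegree := by
  classical
  have hpos : (0 : ℝ) < G.maxDegree := by
    exact_mod_cast (hdeg r).trans_le (G.degree_le_maxDegree r)
  have hdet : ∀ t, DeterminedAt X Y (t + 1) fun ω =>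
      SurvivesGreedyAt G (X · ω) (Y · ω) t ∧ G.dist (Y (t + 1) ω) (X (t + 1) ω) ≤ 1 := fun t =>
    ((determinedAt_survivesGreedyAt t).mono t.le_succ).comp₂
      ((determinedAt_cop (t + 1).le_succ).comp₂ (determinedAt_robber le_rfl)
        fun a b => G.dist a b ≤ 1) And
  have hscaled : ENNReal.ofReal (G.maxDegree : ℝ)⁻¹ *
      ∑' t, P {ω | SurvivesGreedyAt G (X · ω) (Y · ω) t} ≤ 1 := by
    rw [← ENNReal.tsum_mul_left]
    refine ENNReal.tsum_le_of_sum_range_le fun N => ?_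
    calc ∑ t ∈ Finset.range N, ENNReal.ofReal (G.maxDegree : ℝ)⁻¹ *
          P {ω | SurvivesGreedyAt G (X · ω) (Y · ω) t}
        ≤ ∑ t ∈ Finset.range N, P {ω | SurvivesGreedyAt G (X · ω) (Y · ω) t ∧
            G.dist (Y (t + 1) ω) (X (t + 1) ω) ≤ 1} := by
          refine Finset.sum_le_sum fun t _ => h.ofReal_mul_measure_le 1 1
            (determinedAt_survivesGreedyAt t) (determinedAt_cop le_rfl) ?_
          filter_upwards [h.ae_adj] with ω hω hs
          obtain ⟨b, hadj, hb⟩ := hs.exists_adj_dist_le_one hG (hF ω) hω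
          refine (inv_anti₀ (Nat.cast_pos.2 (hdeg _))
            (Nat.cast_le.2 (G.degree_le_maxDegree (X t ω)))).trans ?_
          have hball : ballInd G (Y (t + 1) ω) 1 b = 1 := Set.indicator_of_mem hb 1
          exact inv_degree_le_walkAvg (ballInd_nonneg _ 1) hadj hball.ge
      _ ≤ ∫⁻ _, 1 ∂P := by
          rw [← lintegral_count P fun t => h.measurableSet_of_determinedAt (hdet t)]
          exact lintegral_mono_fn' le_rfl fun ω =>
            Nat.cast_le_one.2 <| by convert (hF ω).count_survivesGreedyAt_near_le_one hG N
      _ = 1 := by rw [lintegral_one, measure_univ]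
  rwa [ENNReal.ofReal_inv_of_pos hpos, ENNReal.inv_mul_le_iff (ENNReal.ofReal_pos.2 hpos).ne'
    ENNReal.ofReal_ne_top, mul_one, ENNReal.ofReal_natCast] at hscaled

theorem expectedCaptureTime_le_tsum_measure_freeAt (h : IsDrunkGame G P X Y r c) :
    expectedCaptureTime P X Y ≤ ∑' t, P {ω | FreeAt (X · ω) (Y · ω) t} := by
  classical
  have hm : ∀ t, MeasurableSet {ω | FreeAt (X · ω) (Y · ω) t} := fun t =>
    h.measurableSet_of_determinedAt (determinedAt_freeAt t)
  calc expectedCaptureTime P X Y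
      ≤ ∫⁻ ω, ∑' t, {ω | FreeAt (X · ω) (Y · ω) t}.indicator 1 ω ∂P := by
        refine lintegral_mono fun ω => (captureTime_le_tsum _ _).trans_eq ?_
        simp only [Set.indicator_apply, Set.mem_ofPred_eq, Pi.one_apply]
    _ = ∑' t, P {ω | FreeAt (X · ω) (Y · ω) t} := by
        rw [lintegral_tsum fun t => (measurable_one.indicator (hm t)).aemeasurable]
        exact tsum_congr fun t => lintegral_indicator_one (hm t)

theorem expectedCaptureTime_le_add_tsum [IsProbabilityMeasure P] (h : IsDrunkGame G P X Y r c)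
    (hF : ∀ ω, FollowsFourStages G (X · ω) (Y · ω)) (hG : G.Connected) :
    expectedCaptureTime P X Y ≤
      G.dist c r + ∫⁻ ω, (stage1Drift G (X · ω) (G.dist c r) : ℝ≥0∞) ∂P +
        (∑' t, P {ω | RetargetsAt G (X · ω) (Y · ω) t}) * 4 +
        ∑' t, P {ω | SurvivesGreedyAt G (X · ω) (Y · ω) t} + 1 := by
  classical
  have hfree := fun t => h.measurableSet_of_determinedAt (determinedAt_freeAt t)
  have hretarget := fun t => h.measurableSet_of_determinedAt (determinedAt_retargetsAt (G := G) t)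
  have hsurvive := fun t =>
    h.measurableSet_of_determinedAt (determinedAt_survivesGreedyAt (G := G) t)
  refine h.expectedCaptureTime_le_tsum_measure_freeAt.trans
    (ENNReal.tsum_le_of_sum_range_le fun N => ?_)
  rw [← lintegral_count P hfree]
  calc ∫⁻ ω, (Nat.count (FreeAt (X · ω) (Y · ω)) N : ℝ≥0∞) ∂P
      ≤ ∫⁻ ω, (G.dist c r + (stage1Drift G (X · ω) (G.dist c r) : ℝ≥0∞) +
          Nat.count (RetargetsAt G (X · ω) (Y · ω)) N * 4 +
          Nat.count (SurvivesGreedyAt G (X · ω) (Y · ω)) N + 1) ∂P := by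
        refine lintegral_mono_fn' le_rfl fun ω => ?_
        rw [← h.stage1End_eq ω]
        exact_mod_cast (hF ω).count_freeAt_le hG N
    _ = G.dist c r + ∫⁻ ω, (stage1Drift G (X · ω) (G.dist c r) : ℝ≥0∞) ∂P +
          (∑ t ∈ Finset.range N, P {ω | RetargetsAt G (X · ω) (Y · ω) t}) * 4 +
          ∑ t ∈ Finset.range N, P {ω | SurvivesGreedyAt G (X · ω) (Y · ω) t} + 1 := by
        rw [lintegral_add_right _ measurable_const,
          lintegral_add_right _ (measurable_count hsurvive N),
          lintegral_add_right _ ((measurable_count hretarget N).mul_const 4),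
          lintegral_add_left measurable_const, lintegral_mul_const' _ _ (by norm_num),
          lintegral_count P hretarget, lintegral_count P hsurvive]
        simp only [lintegral_const, measure_univ, mul_one]
    _ ≤ _ := by
        gcongr <;> exact ENNReal.sum_le_tsum _

theorem expectedCaptureTime_le [IsProbabilityMeasure P] (h : IsDrunkGame G P X Y r c)
    (hF : ∀ ω, FollowsFourStages G (X · ω) (Y · ω)) (hG : G.Connected)
    (hdeg : ∀ a, 0 < G.degree a) {p : ℝ} (hp0 : 0 < p)
    (hp : ∀ x, p ≤ (walkAvg G)^[4] (ballInd G x 3) x) {d₁ d₂ : ℝ} (hd₁0 : 0 ≤ d₁) (hd₂0 : 0 ≤ d₂)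
    (hd₁ : ∫⁻ ω, (stage1Drift G (X · ω) (G.dist c r) : ℝ≥0∞) ∂P ≤ ENNReal.ofReal d₁)
    (hd₂ : ∫⁻ ω, (stage2Drift G (X · ω) (G.dist c r) : ℝ≥0∞) ∂P ≤ ENNReal.ofReal d₂) :
    expectedCaptureTime P X Y ≤
      ENNReal.ofReal (G.dist c r + d₁ + d₂ / p * 4 + G.maxDegree + 1) := by
  have hretarget : ∑' t, P {ω | RetargetsAt G (X · ω) (Y · ω) t} ≤ ENNReal.ofReal (d₂ / p) := by
    rw [ENNReal.ofReal_div_of_pos hp0, ENNReal.le_div_iff_mul_le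
      (Or.inl (ENNReal.ofReal_pos.2 hp0).ne') (Or.inl ENNReal.ofReal_ne_top), mul_comm]
    exact (h.ofReal_mul_tsum_measure_retargetsAt_le hF hG hp).trans hd₂
  calc expectedCaptureTime P X Y
      ≤ G.dist c r + ENNReal.ofReal d₁ + ENNReal.ofReal (d₂ / p) * 4 + G.maxDegree + 1 := by
        grw [h.expectedCaptureTime_le_add_tsum hF hG, hd₁, hretarget,
          h.tsum_measure_survivesGreedyAt_le hF hG hdeg]
    _ = _ := by
        rw [ENNReal.ofReal_add (by positivity) zero_le_one,
          ENNReal.ofReal_add (by positivity) (by positivity),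
          ENNReal.ofReal_add (by positivity) (by positivity),
          ENNReal.ofReal_add (by positivity) hd₁0, ENNReal.ofReal_mul (by positivity)]
        simp only [ENNReal.ofReal_natCast, ENNReal.ofReal_one, ENNReal.ofReal_ofNat]

end IsDrunkGame

/-- The error term `f` of the theorem. Its exponent `11/12 = 1/4 + 2/3` combines the expected length
`n ^ (1/4)` of Stage 2 with the waiting time `n ^ (2/3)` for a gain in Stage 3. -/
noncomputable def captureError (n : ℕ) : ℝ :=
  10 * (Real.log n + 11) ^ 2 * (n : ℝ) ^ (11 / 12 : ℝ)

theorem captureError_isLittleO : captureError =o[atTop] fun n : ℕ => (n : ℝ) := by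
  have hconst : (fun _ : ℝ => (11 : ℝ)) =o[atTop] fun x : ℝ => x ^ (1 / 24 : ℝ) :=
    isLittleO_const_left.2 <| Or.inr <|
      tendsto_norm_atTop_atTop.comp (tendsto_rpow_atTop (by norm_num))
  have hlog : (fun x : ℝ => 10 * (Real.log x + 11) ^ 2) =o[atTop]
      fun x : ℝ => (x ^ (1 / 24 : ℝ)) ^ 2 :=
    (((isLittleO_log_rpow_atTop (by norm_num)).add hconst).pow two_pos).const_mul_left 10
  have herror : (fun x : ℝ => 10 * (Real.log x + 11) ^ 2 * x ^ (11 / 12 : ℝ)) =o[atTop] id := by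
    refine (hlog.mul_isBigO (isBigO_refl (fun x : ℝ => x ^ (11 / 12 : ℝ)) atTop)).congr'
      EventuallyEq.rfl ?_
    filter_upwards [eventually_gt_atTop 0] with x hx
    rw [← Real.rpow_natCast, ← Real.rpow_mul hx.le, ← Real.rpow_add hx]
    norm_num
  exact herror.comp_tendsto tendsto_natCast_atTop_atTop

theorem le_captureError {n m : ℕ} (hn : 1 ≤ n) (hm : m ≤ n) {L : ℝ} (hL : L = Real.log n + 10) :
    L * √m + L * ((n : ℝ) ^ (1 / 4 : ℝ) + L * √m / (n : ℝ) ^ (1 / 4 : ℝ)) /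
      (3 / 7 * (n : ℝ) ^ (-(2 / 3) : ℝ)) * 4 + 3 ≤ captureError n := by
  have hn1 : (1 : ℝ) ≤ n := Nat.one_le_cast.2 hn
  have hn0 : (0 : ℝ) < n := zero_lt_one.trans_le hn1
  have hL10 : 10 ≤ L := by linarith [Real.log_natCast_nonneg n]
  set a := (n : ℝ) ^ (1 / 4 : ℝ)
  set b := (n : ℝ) ^ (2 / 3 : ℝ)
  set e := (n : ℝ) ^ (11 / 12 : ℝ)
  have : 0 < a := Real.rpow_pos_of_pos hn0 _
  have he : 1 ≤ e := Real.one_le_rpow hn1 (by norm_num)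
  have hsqrt : √m ≤ √n := Real.sqrt_le_sqrt (Nat.cast_le.2 hm)
  have hsqrt_eq : √n = a * a := by
    rw [Real.sqrt_eq_rpow, ← Real.rpow_add hn0]
    norm_num
  have hsqrt_le : √n ≤ e := by
    rw [Real.sqrt_eq_rpow]
    exact Real.rpow_le_rpow_of_exponent_le hn1 (by norm_num)
  have hab : a * b = e := by
    rw [← Real.rpow_add hn0]
    norm_num [e]
  calc L * √m + L * (a + L * √m / a) / (3 / 7 * (n : ℝ) ^ (-(2 / 3) : ℝ)) * 4 + 3
      ≤ L * √n + L * (a + L * √n / a) / (3 / 7 * (n : ℝ) ^ (-(2 / 3) : ℝ)) * 4 + 3 := by gcongr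
    _ = L * √n + 28 / 3 * L * (L + 1) * e + 3 := by
        rw [Real.rpow_neg hn0.le, ← hab, hsqrt_eq]
        field_simp
        ring
    _ ≤ L * e + 28 / 3 * L * (L + 1) * e + 3 * e := by
        gcongr
        linarith
    _ = (L + 28 / 3 * L * (L + 1) + 3) * e := by ring
    _ ≤ 10 * (L + 1) ^ 2 * e := by
        gcongr
        nlinarith
    _ = captureError n := by rw [hL, captureError, add_assoc, show (10 : ℝ) + 1 = 11 by norm_num]

theorem expectedCaptureTime_eq_zero {V Ω : Type*} [MeasurableSpace Ω] {P : Measure Ω}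
    {X Y : ℕ → Ω → V} (h : ∀ ω, X 0 ω = Y 0 ω) : expectedCaptureTime P X Y = 0 := by
  have hzero : ∀ ω, captureTime (X · ω) (Y · ω) = 0 := fun ω =>
    nonpos_iff_eq_zero.1 (iInf₂_le (0 : ℕ) (Or.inl (h ω)))
  simp only [expectedCaptureTime, hzero, ENat.toENNReal_zero, lintegral_zero]

theorem IsDrunkGame.expectedCaptureTime_le_diam_add {V Ω : Type*} [Fintype V] {G : SimpleGraph V}
    [DecidableRel G.Adj] [MeasurableSpace Ω] {P : Measure Ω} [IsProbabilityMeasure P]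
    {X Y : ℕ → Ω → V} {r c : V} (h : IsDrunkGame G P X Y r c) (hG : G.Connected)
    (hF : ∀ ω, FollowsFourStages G (X · ω) (Y · ω)) (hrc : r ≠ c) :
    expectedCaptureTime P X Y ≤
      ENNReal.ofReal (G.diam + G.maxDegree + (captureError (Fintype.card V) - 2)) := by
  have : Nontrivial V := ⟨r, c, hrc⟩
  have hdeg : ∀ a, 0 < G.degree a := fun a => hG.preconnected.degree_pos_of_nontrivial a
  have hdist : G.dist c r ≤ G.diam :=
    SimpleGraph.dist_le_diam (SimpleGraph.connected_iff_ediam_ne_top.1 hG)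
  have hdist_card : G.dist c r ≤ Fintype.card V := by
    obtain ⟨w, hpath, hlength⟩ := hG.exists_path_of_dist c r
    exact hlength ▸ hpath.length_lt.le
  set n := Fintype.card V
  have hn : 1 ≤ n := Fintype.card_pos
  have hn0 : (0 : ℝ) < n := Nat.cast_pos.2 hn
  set q := (n : ℝ) ^ (-(2 / 3) : ℝ) with hq
  have hq0 : 0 < q := Real.rpow_pos_of_pos hn0 _
  have hqn : q ^ 3 * (n : ℝ) ^ 2 = 1 := by
    rw [hq, ← Real.rpow_natCast, ← Real.rpow_mul hn0.le, ← Real.rpow_natCast (n : ℝ) 2,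
      ← Real.rpow_add hn0]
    norm_num
  have ha : 0 < (n : ℝ) ^ (1 / 4 : ℝ) := Real.rpow_pos_of_pos hn0 _
  have : 0 ≤ Real.log n + 10 := add_nonneg (Real.log_natCast_nonneg n) (by norm_num)
  have herror := le_captureError hn hdist_card rfl
  have hdist' : (G.dist c r : ℝ) ≤ G.diam := Nat.cast_le.2 hdist
  refine (h.expectedCaptureTime_le hF hG hdeg (p := 3 / 7 * q) (by positivity)
    (walkAvg_iterate_four_ballInd_ge hdeg hq0 hqn) (by positivity) (by positivity)
    (h.lintegral_stage1Drift_le hdeg _) (h.lintegral_stage2Drift_le hdeg _ ha)).trans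
    (ENNReal.ofReal_le_ofReal ?_)
  linarith

end DrunkRobber

theorem theorem3p6 :
    ∃ f : ℕ → ℝ, f =o[atTop] (fun n : ℕ => (n : ℝ)) ∧
      ∀ (V : Type*) [Fintype V] (G : SimpleGraph V) [DecidableRel G.Adj], G.Connected →
      ∀ (Ω : Type*) [MeasurableSpace Ω] (P : Measure Ω) [IsProbabilityMeasure P]
        (X Y : ℕ → Ω → V) (r c : V),
        DrunkRobber.IsDrunkGame G P X Y r c →
        (∀ ω, DrunkRobber.FollowsFourStages G (fun t => X t ω) (fun t => Y t ω)) →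
        DrunkRobber.expectedCaptureTime P X Y
            ≤ ENNReal.ofReal ((G.diam : ℝ) + (G.maxDegree : ℝ) + f (Fintype.card V)) ∧
          DrunkRobber.expectedCaptureTime P X Y
            ≤ ENNReal.ofReal ((Fintype.card V : ℝ) + f (Fintype.card V)) := by
  refine ⟨DrunkRobber.captureError, DrunkRobber.captureError_isLittleO, ?_⟩
  intro V _ G _ hG Ω _ P _ X Y r c h hF
  by_cases hrc : r = c
  · have h0 : ∀ ω, X 0 ω = Y 0 ω := fun ω => by rw [h.robber_start, h.cop_start, hrc]
    rw [DrunkRobber.expectedCaptureTime_eq_zero h0]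
    exact ⟨zero_le, zero_le⟩
  · have h1 := h.expectedCaptureTime_le_diam_add hG hF hrc
    have h2 : (G.diam : ℝ) + G.maxDegree ≤ Fintype.card V + 2 := by
      exact_mod_cast DrunkRobber.diam_add_maxDegree_le hG
    exact ⟨h1.trans (ENNReal.ofReal_le_ofReal (by linarith)),
      h1.trans (ENNReal.ofReal_le_ofReal (by linarith))⟩
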